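/- Let $\Gamma$ be a right-angled Coxeter group with finite generating set $S$: $\Gamma$ is generated by $S$ subject to the relations $(st)^{m_{s,t}}=1$ for $s,t\in S$, where $(m_{s,t})$ is a symmetric $S\times S$ matrix with $m_{s,s}=1$ and $m_{s,t}\in\{0,2\}$ for $s\neq t$ ($m_{s,t}=0$ meaning that there is no relation). Let $C(\Gamma,S)$ be its Cayley graph, with the simplicial (path) metric in which every edge has length $1$, and suppose that $\Gamma$ is Gromov-hyperbolic, i.e. that this metric is Gromov-hyperbolic. Let the nerve of $(\Gamma,S)$ be the simplicial complex with vertex set $S$ in which a nonempty finite set of generators spans a simplex if and only if $m_{s,t}=2$ for all distinct $s,t$ in it, and let $n$ be its chromatic number, i.e. the least number of colours needed to colour $S$ so that any two generators joined by an edge of the nerve have different colours. Let $T$ be the binary tree, i.e. the rooted tree whose vertices are the finite sequences in $\{0,1\}$, two of them being joined by an edge if one is obtained from the other by erasing its last term, with the simplicial metric. Then there is a quasi-isometric embedding $$\psi : C(\Gamma,S)\longrightarrow \underbrace{T\times\cdots\times T}_{n},$$ where the product carries the $l_1$-product metric. That is, there are a map $\psi$ from $\Gamma$ to $n$-tuples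 of vertices of $T$ and constants $L\ge 1$, $C\ge 0$ such that for all $\gamma,\gamma'\in\Gamma$ $$\tfrac1L\,d(\gamma,\gamma')-C\;\le\;\sum_{i=1}^n d_T\bigl(\psi_i(\gamma),\psi_i(\gamma')\bigr)\;\le\; L\,d(\gamma,\gamma')+C .$$ -/

import Mathlib

namespace RACG

/-! ### Right-angled Coxeter groups, their nerves and their Cayley graphs -/

/-- A Coxeter matrix is right-angled if all its entries are `0`, `1` or `2`.
An entry `0` means that there is no relation between the two generators. -/
def IsRightAngled {S : Type*} (M : CoxeterMatrix S) : Prop :=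
  ∀ s t : S, M s t = 0 ∨ M s t = 1 ∨ M s t = 2

/-- The nerve of the Coxeter system with matrix `M`, in the right-angled case: the vertices are
the generators, and a nonempty finite set of generators spans a simplex if and only if
`M s t = 2` for all distinct `s`, `t` in it. -/
def nerve {S : Type*} (M : CoxeterMatrix S) : AbstractSimplicialComplex S where
  faces := {σ | σ.Nonempty ∧ ∀ s ∈ σ, ∀ t ∈ σ, s ≠ t → M s t = 2}
  isRelLowerSet_faces := by
    intro σ hσ
    refine ⟨hσ.1, ?_⟩
    intro τ hτσ hτ
    exact ⟨hτ, fun s hs t ht hst => hσ.2 s (hτσ hs) t (hτσ ht) hst⟩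
  singleton_mem := by
    intro v
    refine ⟨Finset.singleton_nonempty v, ?_⟩
    intro s hs t ht hst
    exact absurd ((Finset.mem_singleton.mp hs).trans (Finset.mem_singleton.mp ht).symm) hst

/-- The 1-skeleton of an abstract simplicial complex, as a graph on its vertices. -/
def oneSkeleton {V : Type*} (K : AbstractSimplicialComplex V) : SimpleGraph V where
  Adj s t := s ≠ t ∧ ∃ e ∈ K.faces, (e : Set V) = {s, t}
  symm := ⟨by
    rintro s t ⟨hst, e, he, h⟩
    exact ⟨hst.symm, e, he, by rw [h, Set.pair_comm]⟩⟩
  loopless := ⟨fun s h => h.1 rfl⟩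

/-- The chromatic number of an abstract simplicial complex is that of its 1-skeleton. -/
noncomputable def chromaticNumber {V : Type*} (K : AbstractSimplicialComplex V) : ℕ∞ :=
  (oneSkeleton K).chromaticNumber

/-- The Cayley graph `C(Γ, S)` of a Coxeter system: elements `g` and `g * s` are joined by an
edge, for every `g` in the group and every generator `s`. -/
def cayleyGraph {S Γ : Type*} [Group Γ] {M : CoxeterMatrix S} (cs : CoxeterSystem M Γ) :
    SimpleGraph Γ :=
  SimpleGraph.mulCayley (Set.range cs.simple)

/-! ### The binary tree -/

/-- The rooted tree `T_Ω`: its vertices are the finite sequences in `Ω`, and two of them are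
joined by an edge if one is obtained from the other by erasing the last term. -/
def rootedTree (Ω : Type*) : SimpleGraph (List Ω) where
  Adj u v := (∃ a, v = u ++ [a]) ∨ (∃ a, u = v ++ [a])
  symm := ⟨fun _ _ h => h.symm⟩
  loopless := ⟨fun u h => by simp at h⟩

/-- The binary tree `T = T_{0,1}`. -/
abbrev binaryTree : SimpleGraph (List (Fin 2)) := rootedTree (Fin 2)

/-! ### Metrics -/

/-- The simplicial (path) metric on the vertices of a graph, every edge having length `1`.
The graphs it is used for are connected, see `cayleyGraph_connected` and
`rootedTree_connected`. -/
noncomputable def graphDist {V : Type*} (G : SimpleGraph V) (x y : V) : ℝ := (G.dist x y : ℝ)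

/-- The `l₁`-product metric on the `n`-fold product of a space with distance function `d`. -/
noncomputable def l1Dist {X : Type*} (d : X → X → ℝ) (n : ℕ) (x y : Fin n → X) : ℝ :=
  ∑ i, d (x i) (y i)

/-- The Gromov product `(x|y)_w`. -/
noncomputable def gromovProduct {X : Type*} (d : X → X → ℝ) (w x y : X) : ℝ :=
  (d x w + d y w - d x y) / 2

/-- Gromov hyperbolicity of a metric `d`. -/
def IsGromovHyperbolic {X : Type*} (d : X → X → ℝ) : Prop :=
  ∃ δ : ℝ, 0 ≤ δ ∧ ∀ w x y z : X,
    min (gromovProduct d w x y) (gromovProduct d w y z) - δ ≤ gromovProduct d w x z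

/-- `f` is a quasi-isometric embedding with respect to the distance functions `dX`, `dY`. -/
def IsQuasiIsometricEmbedding {X Y : Type*} (dX : X → X → ℝ) (dY : Y → Y → ℝ) (f : X → Y) :
    Prop :=
  ∃ L C : ℝ, 1 ≤ L ∧ 0 ≤ C ∧ ∀ x y : X,
    L⁻¹ * dX x y - C ≤ dY (f x) (f y) ∧ dY (f x) (f y) ≤ L * dX x y + C

/-! ### The graphs are connected -/

theorem cayleyGraph_connected {S Γ : Type*} [Group Γ] {M : CoxeterMatrix S}
    (cs : CoxeterSystem M Γ) : (cayleyGraph cs).Connected := by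
  have key : ∀ g : Γ, (cayleyGraph cs).Reachable 1 g := by
    intro g
    induction g using cs.simple_induction_right with
    | one => exact SimpleGraph.Reachable.refl _
    | mul_simple_right w i ih =>
      by_cases h : w = w * cs.simple i
      · rw [← h]; exact ih
      · refine ih.trans (SimpleGraph.Adj.reachable ?_)
        rw [cayleyGraph, SimpleGraph.mulCayley_adj']
        exact ⟨h, cs.simple i, ⟨i, rfl⟩, Or.inl rfl⟩
  have : Nonempty Γ := ⟨1⟩
  exact ⟨fun x y => (key x).symm.trans (key y)⟩

theorem rootedTree_connected (Ω : Type*) : (rootedTree Ω).Connected := by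
  have key : ∀ u : List Ω, (rootedTree Ω).Reachable [] u := by
    intro u
    induction u using List.reverseRecOn with
    | nil => exact SimpleGraph.Reachable.refl _
    | append_singleton u a ih => exact ih.trans (SimpleGraph.Adj.reachable (Or.inl ⟨a, rfl⟩))
  exact ⟨fun x y => (key x).symm.trans (key y)⟩

end RACG

/-!
Fix a colouring of the generators with `n` colours in which commuting generators get different
colours. A wall of the Cayley graph is represented by its gate, the element nearest to `1` behind
the wall; gates are the elements with exactly one right descent (`IsGate`), and the wall separates
`g` from `1` if and only if its gate lies below `g` in the weak order. The distance of `g` and `h`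
is the number of walls separating them (`card_symmDiff_walls`), and the walls of one colour
separating `g` from `1` form a chain (`weakLE_or_weakLE_of_mem_colorWalls`), because two descents of
an element commute. So `g` is described by `n` chains of walls, that is by a vertex in a product of
`n` trees, which however have infinite valence. All this rests on two facts about right descents,
`comm_of_isRightDescent` and `isRightDescent_mul_simple_iff`, which are read off from an action of
the group on the heaps of reduced words.

To reach the binary tree, every wall gets a label, a word of fixed length in `{0, 1}`, and the
`i`-th coordinate of `g` is the concatenation of the labels along its chain of colour `i`
(`labelMap`). This is Lipschitz for any labeling. It is a quasi-isometric embedding if, for all `g`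
and `h` at a large distance, the labels tell apart a fixed proportion of the walls behind the branch
point of the geodesics from `1` to `g` and to `h`. For one pair `(g, h)` a random labeling fails to
do so with a probability exponentially small in the distance. Hyperbolicity makes these conditions
local: apart from boundedly many walls in each colour, the gates of the walls between the branch
point and `g` are within `d(g, h) + δ` of `g` (`length_nthWall_inv_mul_le`). Hence only
exponentially many of the conditions of a given size involve a given wall
(`isSparse_wallConflicts`), and a labeling with finitely many labels satisfying all of them exists
by a counting argument in the manner of Rosenfeld together with compactness
(`ConflictSystem.exists_labeling`).
-/

namespace RACG

/-! ### Heaps of reduced words -/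

section Heaps

variable {S : Type*} (M : CoxeterMatrix S)

/-- The letter `u` is recorded in the projection of a word to the pair `{s, t}`: it is one of the
two letters, and these are equal or do not commute. -/
def Recorded (u s t : S) : Prop := (s = u ∨ t = u) ∧ M s t ≠ 2

open Classical in
/-- Adds a last letter `u` to a family of projections; words are stored with the last letter
first. -/
noncomputable def push (u : S) (x : S → S → List S) : S → S → List S :=
  fun s t => if Recorded M u s t then u :: x s t else x s t

open Classical in
/-- Deletes the last letter from all the projections that record `u`. -/
noncomputable def pop (u : S) (x : S → S → List S) : S → S → List S :=
  fun s t => if Recorded M u s t then (x s t).tail else x s t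

/-- The letter `u` can be moved to the end of the word with projections `x`. -/
def Removable (u : S) (x : S → S → List S) : Prop :=
  ∀ s t, Recorded M u s t → (x s t).head? = some u

/-- The heaps of reduced words: a word is represented by its projections to the pairs of equal or
non-commuting letters, and no letter is added where it would cancel. -/
inductive IsHeap : (S → S → List S) → Prop
  | nil : IsHeap fun _ _ => []
  | push (u : S) (x : S → S → List S) : IsHeap x → ¬ Removable M u x → IsHeap (push M u x)

open Classical in
/-- Right multiplication by the generator `u`, on heaps. -/
noncomputable def toggle (u : S) (x : S → S → List S) : S → S → List S :=
  if Removable M u x then pop M u x else push M u x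

variable {M}

theorem ne_of_comm {s t : S} (h : M s t = 2) : s ≠ t := by
  rintro rfl
  simp at h

theorem not_recorded_of_comm {s t a b : S} (h : M s t = 2) (hs : Recorded M s a b) :
    ¬ Recorded M t a b := by
  rintro ⟨h1, h2⟩
  have hne := ne_of_comm h
  have h' : M t s = 2 := by rw [M.symmetric]; exact h
  rcases hs.1 with rfl | rfl <;> rcases h1 with rfl | rfl <;> contradiction

theorem pop_push (u : S) (x : S → S → List S) : pop M u (push M u x) = x := by
  funext s t
  by_cases h : Recorded M u s t <;> simp [pop, push, h]

theorem removable_push_self (u : S) (x : S → S → List S) : Removable M u (push M u x) := by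
  intro s t h
  simp [push, h]

theorem removable_push_iff {s t : S} (h : M s t = 2) (x : S → S → List S) :
    Removable M s (push M t x) ↔ Removable M s x := by
  refine forall_congr' fun a => forall_congr' fun b => imp_congr_right fun hab => ?_
  simp [push, not_recorded_of_comm h hab]

theorem removable_pop_iff {s t : S} (h : M s t = 2) (x : S → S → List S) :
    Removable M s (pop M t x) ↔ Removable M s x := by
  refine forall_congr' fun a => forall_congr' fun b => imp_congr_right fun hab => ?_
  simp [pop, not_recorded_of_comm h hab]

theorem removable_toggle_iff {s t : S} (h : M s t = 2) (x : S → S → List S) :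
    Removable M s (toggle M t x) ↔ Removable M s x := by
  unfold toggle
  split_ifs
  · exact removable_pop_iff h x
  · exact removable_push_iff h x

theorem comm_of_removable {s t : S} (hst : s ≠ t) {x : S → S → List S}
    (hs : Removable M s x) (ht : Removable M t x) : M s t = 2 := by
  by_contra h
  have h1 := hs s t ⟨Or.inl rfl, h⟩
  have h2 := ht s t ⟨Or.inr rfl, h⟩
  rw [h1] at h2
  exact hst (Option.some_injective _ h2)

theorem push_comm {s t : S} (h : M s t = 2) (x : S → S → List S) :
    push M s (push M t x) = push M t (push M s x) := by
  funext a b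
  by_cases hs : Recorded M s a b
  · simp [push, hs, not_recorded_of_comm h hs]
  · simp [push, hs]

theorem toggle_comm {s t : S} (h : M s t = 2) (x : S → S → List S) :
    toggle M s (toggle M t x) = toggle M t (toggle M s x) := by
  have h' : M t s = 2 := by rw [M.symmetric]; exact h
  by_cases r : Removable M s x <;> by_cases r' : Removable M t x <;>
    simp only [toggle, r, r', removable_push_iff h, removable_pop_iff h, removable_push_iff h',
      removable_pop_iff h', if_true, if_false] <;>
    funext a b <;>
    by_cases hs : Recorded M s a b <;>
    simp [push, pop, hs, not_recorded_of_comm h]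

/-- A removable letter of the heap of a reduced word is a last letter of some spelling of it. -/
theorem IsHeap.exists_push {y : S → S → List S} (hy : IsHeap M y) {u : S}
    (hu : Removable M u y) : ∃ x, IsHeap M x ∧ ¬ Removable M u x ∧ y = RACG.push M u x := by
  induction hy with
  | nil => simpa using hu u u ⟨Or.inl rfl, by simp⟩
  | push t x hx hxt ih =>
    by_cases htu : u = t
    · subst htu
      exact ⟨x, hx, hxt, rfl⟩
    have h : M u t = 2 := comm_of_removable htu hu (removable_push_self t x)
    have h' : M t u = 2 := by rw [M.symmetric]; exact h
    obtain ⟨z, hz, hzu, rfl⟩ := ih ((removable_push_iff h x).1 hu)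
    rw [removable_push_iff h'] at hxt
    exact ⟨_, hz.push t z hxt, by rwa [removable_push_iff h], push_comm h' z⟩

theorem IsHeap.toggle {x : S → S → List S} (hx : IsHeap M x) (u : S) :
    IsHeap M (toggle M u x) := by
  by_cases h : Removable M u x
  · obtain ⟨y, hy, -, rfl⟩ := hx.exists_push h
    rwa [RACG.toggle, if_pos h, pop_push]
  · rw [RACG.toggle, if_neg h]
    exact hx.push u x h

theorem IsHeap.toggle_toggle {x : S → S → List S} (hx : IsHeap M x) (u : S) :
    RACG.toggle M u (RACG.toggle M u x) = x := by
  by_cases h : Removable M u x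
  · obtain ⟨y, hy, hyu, rfl⟩ := hx.exists_push h
    rw [RACG.toggle.eq_def M u (RACG.push M u y), if_pos h, pop_push, RACG.toggle, if_neg hyu]
  · rw [RACG.toggle.eq_def M u x, if_neg h, RACG.toggle, if_pos (removable_push_self u x),
      pop_push]

variable (M) in
/-- The permutation of the heaps given by right multiplication with `u`. -/
noncomputable def togglePerm (u : S) : Equiv.Perm {x : S → S → List S // IsHeap M x} :=
  Function.Involutive.toPerm (fun x => ⟨toggle M u x.1, x.2.toggle u⟩)
    fun x => Subtype.ext (x.2.toggle_toggle u)

theorem togglePerm_isLiftable (hM : IsRightAngled M) : M.IsLiftable (togglePerm M) := by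
  intro s t
  have hsq : ∀ u, togglePerm M u * togglePerm M u = 1 := fun u =>
    Equiv.ext fun x => Subtype.ext (x.2.toggle_toggle u)
  rcases hM s t with h | h | h
  · rw [h, pow_zero]
  · have hst : s = t := by
      by_contra hst
      exact M.off_diagonal s t hst h
    subst hst
    rw [h, pow_one, hsq]
  · have hc : togglePerm M s * togglePerm M t = togglePerm M t * togglePerm M s :=
      Equiv.ext fun x => Subtype.ext (toggle_comm h x.1)
    rw [h, pow_two, mul_assoc, ← mul_assoc (togglePerm M t), ← hc, mul_assoc, hsq, mul_one, hsq]

end Heaps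

/-! ### Right descents -/

section Descents

variable {S Γ : Type*} [Group Γ] {M : CoxeterMatrix S} (cs : CoxeterSystem M Γ)

/-- The heap of an element of the group. -/
noncomputable def heap (hM : IsRightAngled M) (g : Γ) : S → S → List S :=
  (cs.lift ⟨togglePerm M, togglePerm_isLiftable hM⟩ g⁻¹ ⟨_, IsHeap.nil⟩).1

theorem heap_mul_simple (hM : IsRightAngled M) (g : Γ) (s : S) :
    heap cs hM (g * cs.simple s) = toggle M s (heap cs hM g) := by
  unfold heap
  rw [mul_inv_rev, cs.inv_simple, map_mul, cs.lift_apply_simple]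
  rfl

theorem heap_one (hM : IsRightAngled M) : heap cs hM 1 = fun _ _ => [] := by
  simp [heap]


theorem simple_mul_comm {s t : S} (h : M s t = 2) (g : Γ) :
    g * cs.simple s * cs.simple t = g * cs.simple t * cs.simple s := by
  have h1 := cs.simple_mul_simple_pow s t
  rw [h, pow_two] at h1
  have h2 : cs.simple s * cs.simple t = cs.simple t * cs.simple s := by
    have := eq_inv_of_mul_eq_one_left h1
    simpa using this
  rw [mul_assoc, h2, mul_assoc]

/-- Cancellation in the heap is cancellation in the group, so the heaps are faithful to lengths. -/
theorem length_mul_lt_of_removable (hM : IsRightAngled M) {s : S} {g : Γ}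
    (hs : Removable M s (heap cs hM g)) :
    cs.length (g * cs.simple s) < cs.length g := by
  induction hn : cs.length g using Nat.strong_induction_on generalizing g s with
  | _ n ih =>
  subst hn
  by_cases hg : g = 1
  · subst hg
    rw [heap_one] at hs
    simpa using hs s s ⟨Or.inl rfl, by simp⟩
  obtain ⟨t, ht⟩ := cs.exists_rightDescent_of_ne_one hg
  by_cases hts : t = s
  · exact hts ▸ ht
  obtain ⟨k, rfl⟩ : ∃ k, g = k * cs.simple t := ⟨g * cs.simple t, by simp⟩
  rw [CoxeterSystem.IsRightDescent, cs.simple_mul_simple_cancel_right] at ht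
  have hkt : ¬ Removable M t (heap cs hM k) := fun h => (ih _ ht h rfl).asymm ht
  rw [heap_mul_simple, toggle, if_neg hkt] at hs
  have hst : M s t = 2 := comm_of_removable (Ne.symm hts) hs (removable_push_self t _)
  have hks := ih _ ht ((removable_push_iff hst _).1 hs) rfl
  rw [← simple_mul_comm cs hst]
  have h1 := cs.length_mul_simple (k * cs.simple s) t
  omega

theorem removable_heap_iff (hM : IsRightAngled M) {s : S} {g : Γ} :
    Removable M s (heap cs hM g) ↔ cs.IsRightDescent g s := by
  refine ⟨length_mul_lt_of_removable cs hM, fun h => ?_⟩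
  obtain ⟨k, rfl⟩ : ∃ k, g = k * cs.simple s := ⟨g * cs.simple s, by simp⟩
  rw [CoxeterSystem.IsRightDescent, cs.simple_mul_simple_cancel_right] at h
  have hk : ¬ Removable M s (heap cs hM k) := fun h' =>
    (length_mul_lt_of_removable cs hM h').asymm h
  rw [heap_mul_simple, toggle, if_neg hk]
  exact removable_push_self s _

/-- Two different right descents of an element commute. -/
theorem comm_of_isRightDescent (hM : IsRightAngled M) {s t : S} (hst : s ≠ t) {g : Γ}
    (hs : cs.IsRightDescent g s)
    (ht : cs.IsRightDescent g t) : M s t = 2 :=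
  comm_of_removable hst ((removable_heap_iff cs hM).2 hs) ((removable_heap_iff cs hM).2 ht)

theorem isRightDescent_mul_simple_iff (hM : IsRightAngled M) {s t : S} (h : M s t = 2) (g : Γ) :
    cs.IsRightDescent (g * cs.simple t) s ↔ cs.IsRightDescent g s := by
  rw [← removable_heap_iff cs hM, ← removable_heap_iff cs hM, heap_mul_simple,
    removable_toggle_iff h]

end Descents

/-! ### Gates and walls -/

section WeakOrder

variable {S Γ : Type*} [Group Γ] {M : CoxeterMatrix S} (cs : CoxeterSystem M Γ)

/-- The (right) weak order: `u` is a prefix of a reduced expression of `g`. -/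
def WeakLE : Γ → Γ → Prop :=
  Relation.ReflTransGen fun x y => ∃ s, cs.IsRightDescent y s ∧ x = y * cs.simple s

/-- The element `u` has `s` as its only right descent. Such elements stand for the walls of the
Cayley graph: `u` is the point nearest to `1` in the half-space behind the wall. -/
def IsGate (s : S) (u : Γ) : Prop := ∀ t, cs.IsRightDescent u t ↔ t = s

variable {cs}

theorem weakLE_mul_simple {g : Γ} {s : S} (hs : cs.IsRightDescent g s) :
    WeakLE cs (g * cs.simple s) g :=
  Relation.ReflTransGen.single ⟨s, hs, rfl⟩

theorem WeakLE.eq_or_exists {u g : Γ} (h : WeakLE cs u g) :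
    u = g ∨ ∃ s, cs.IsRightDescent g s ∧ WeakLE cs u (g * cs.simple s) := by
  rcases Relation.ReflTransGen.cases_tail h with rfl | ⟨x, hx, s, hs, rfl⟩
  · exact Or.inl rfl
  · exact Or.inr ⟨s, hs, hx⟩

theorem WeakLE.length_le {u g : Γ} (h : WeakLE cs u g) : cs.length u ≤ cs.length g := by
  induction h with
  | refl => exact le_rfl
  | tail _ h ih =>
    obtain ⟨s, hs, rfl⟩ := h
    exact ih.trans hs.le

theorem WeakLE.eq_of_length_le {u g : Γ} (h : WeakLE cs u g)
    (hl : cs.length g ≤ cs.length u) : u = g := by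
  rcases h.eq_or_exists with h | ⟨s, hs, h⟩
  · exact h
  · have h1 := h.length_le
    have h2 : cs.length (g * cs.simple s) < cs.length g := hs
    omega

theorem WeakLE.antisymm {u g : Γ} (h : WeakLE cs u g) (h' : WeakLE cs g u) : u = g :=
  h.eq_of_length_le h'.length_le

theorem WeakLE.trans {u v g : Γ} (h : WeakLE cs u v) (h' : WeakLE cs v g) : WeakLE cs u g :=
  Relation.ReflTransGen.trans h h'

theorem not_weakLE_mul_simple {g : Γ} {s : S} (hs : cs.IsRightDescent g s) :
    ¬ WeakLE cs g (g * cs.simple s) := fun h => h.length_le.not_gt hs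

theorem IsGate.isRightDescent {s : S} {u : Γ} (h : IsGate cs s u) : cs.IsRightDescent u s :=
  (h s).2 rfl

theorem IsGate.unique {s t : S} {u : Γ} (h : IsGate cs s u) (h' : IsGate cs t u) : s = t :=
  (h' s).1 h.isRightDescent

/-- Strong induction along the weak order. -/
theorem descent_induction {p : Γ → Prop}
    (h : ∀ g, (∀ s, cs.IsRightDescent g s → p (g * cs.simple s)) → p g) (g : Γ) : p g := by
  induction hn : cs.length g using Nat.strong_induction_on generalizing g with
  | _ n ih => exact h g fun s hs => ih _ (hn ▸ hs) _ rfl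

theorem isRightDescent_mul_of_ne (hM : IsRightAngled M) {s t : S} (hst : s ≠ t) {g : Γ}
    (hs : cs.IsRightDescent g s) (ht : cs.IsRightDescent g t) :
    cs.IsRightDescent (g * cs.simple t) s :=
  (isRightDescent_mul_simple_iff cs hM (comm_of_isRightDescent cs hM hst hs ht) g).2 hs

theorem mul_comm_of_isRightDescent (hM : IsRightAngled M) {s t : S} {g : Γ}
    (hs : cs.IsRightDescent g s) (ht : cs.IsRightDescent g t) :
    g * cs.simple s * cs.simple t = g * cs.simple t * cs.simple s := by
  by_cases hst : s = t
  · rw [hst]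
  · exact simple_mul_comm cs (comm_of_isRightDescent cs hM hst hs ht) g

/-- Only a generator of the type of `u` can be the last one to be removed from a reduced
expression before `u` stops being a prefix. -/
theorem IsGate.weakLE_mul_simple (hM : IsRightAngled M) {s t : S} {u g : Γ}
    (hu : IsGate cs s u) (hug : WeakLE cs u g) (ht : cs.IsRightDescent g t) (hst : t ≠ s) :
    WeakLE cs u (g * cs.simple t) := by
  induction g using descent_induction (cs := cs) with
  | h g ih =>
  rcases hug.eq_or_exists with rfl | ⟨r, hr, hur⟩
  · exact absurd ((hu t).1 ht) hst
  by_cases hrt : r = t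
  · exact hrt ▸ hur
  have h := ih r hr hur (isRightDescent_mul_of_ne hM (Ne.symm hrt) ht hr)
  rw [mul_comm_of_isRightDescent hM hr ht] at h
  exact h.trans (RACG.weakLE_mul_simple (isRightDescent_mul_of_ne hM hrt hr ht))

/-- Every right descent `s` of `g` crosses exactly one wall. -/
theorem existsUnique_gate (hM : IsRightAngled M) {s : S} {g : Γ} (hs : cs.IsRightDescent g s) :
    ∃! u, IsGate cs s u ∧ WeakLE cs u g ∧ ¬ WeakLE cs u (g * cs.simple s) := by
  induction g using descent_induction (cs := cs) with
  | h g ih =>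
  by_cases hg : IsGate cs s g
  · refine ⟨g, ⟨hg, .refl, not_weakLE_mul_simple hs⟩, ?_⟩
    rintro u ⟨-, hug, hus⟩
    rcases hug.eq_or_exists with h | ⟨r, hr, hur⟩
    · exact h
    · rw [(hg r).1 hr] at hur
      exact absurd hur hus
  obtain ⟨t, ht, hts⟩ : ∃ t, cs.IsRightDescent g t ∧ t ≠ s := by
    by_contra h
    push Not at h
    exact hg fun t => ⟨h t, fun h => h ▸ hs⟩
  have hst := isRightDescent_mul_of_ne hM hts.symm hs ht
  have hts' := isRightDescent_mul_of_ne hM hts ht hs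
  have hc := mul_comm_of_isRightDescent hM hs ht
  obtain ⟨u, ⟨hu, hut, hus⟩, huniq⟩ := ih t ht hst
  refine ⟨u, ⟨hu, hut.trans (weakLE_mul_simple ht), fun h => hus ?_⟩, ?_⟩
  · rw [← hc]
    exact hu.weakLE_mul_simple hM h hts' hts
  · rintro v ⟨hv, hvg, hvs⟩
    refine huniq v ⟨hv, hv.weakLE_mul_simple hM hvg ht hts, fun h => hvs ?_⟩
    rw [← hc] at h
    exact h.trans (weakLE_mul_simple hts')

variable (cs) in
/-- The set of the walls separating `g` from `1`, each given by its gate. -/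
def wallSet (g : Γ) : Set Γ := {u | (∃ s, IsGate cs s u) ∧ WeakLE cs u g}

theorem wallSet_mono {u g : Γ} (h : WeakLE cs u g) : wallSet cs u ⊆ wallSet cs g :=
  fun _ hv => ⟨hv.1, hv.2.trans h⟩

theorem wallSet_eq_insert (hM : IsRightAngled M) {s : S} {g u : Γ} (hs : cs.IsRightDescent g s)
    (hu : IsGate cs s u) (hug : WeakLE cs u g) (hus : ¬ WeakLE cs u (g * cs.simple s)) :
    wallSet cs g = insert u (wallSet cs (g * cs.simple s)) := by
  refine Set.Subset.antisymm ?_ ?_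
  · rintro v ⟨⟨t, hv⟩, hvg⟩
    by_cases h : WeakLE cs v (g * cs.simple s)
    · exact Or.inr ⟨⟨t, hv⟩, h⟩
    · have hts : t = s := by
        by_contra hts
        exact h (hv.weakLE_mul_simple hM hvg hs (Ne.symm hts))
      exact Or.inl ((existsUnique_gate hM hs).unique ⟨hts ▸ hv, hvg, h⟩ ⟨hu, hug, hus⟩)
  · rintro v (rfl | hv)
    · exact ⟨⟨s, hu⟩, hug⟩
    · exact wallSet_mono (weakLE_mul_simple hs) hv

theorem wallSet_one : wallSet cs 1 = ∅ := by
  refine Set.eq_empty_of_forall_notMem ?_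
  rintro u ⟨⟨s, hu⟩, h⟩
  have h1 := h.length_le
  rw [cs.length_one, Nat.le_zero, cs.length_eq_zero_iff] at h1
  subst h1
  exact cs.not_isRightDescent_one s hu.isRightDescent

theorem wallSet_finite (hM : IsRightAngled M) (g : Γ) : (wallSet cs g).Finite := by
  induction g using descent_induction (cs := cs) with
  | h g ih =>
  by_cases hg : g = 1
  · rw [hg, wallSet_one]
    exact Set.finite_empty
  · obtain ⟨s, hs⟩ := cs.exists_rightDescent_of_ne_one hg
    obtain ⟨u, ⟨hu, hug, hus⟩, -⟩ := existsUnique_gate hM hs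
    rw [wallSet_eq_insert hM hs hu hug hus]
    exact (ih s hs).insert u

/-- Walls at the top of `g` are maximal among the walls separating `g` from `1`. -/
theorem weakLE_gate_of_not_isRightDescent (hM : IsRightAngled M) {s t : S} {g u v : Γ}
    (hs : cs.IsRightDescent g s) (ht : ¬ cs.IsRightDescent g t)
    (hts : cs.IsRightDescent (g * cs.simple s) t)
    (hug : WeakLE cs u g) (hus : ¬ WeakLE cs u (g * cs.simple s))
    (hv : IsGate cs t v) (hvg : WeakLE cs v (g * cs.simple s)) : WeakLE cs v u := by
  induction g using descent_induction (cs := cs) with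
  | h g ih =>
  rcases hug.eq_or_exists with rfl | ⟨q, hq, huq⟩
  · exact hvg.trans (weakLE_mul_simple hs)
  have hqs : q ≠ s := fun h => hus (h ▸ huq)
  have hqt : q ≠ t := fun h => ht (h ▸ hq)
  have hqs' := isRightDescent_mul_of_ne hM hqs hq hs
  have hc := mul_comm_of_isRightDescent hM hs hq
  have hcomm := comm_of_isRightDescent cs hM hqt hqs' hts
  have hcomm' : M t q = 2 := by rw [M.symmetric]; exact hcomm
  refine ih q hq (isRightDescent_mul_of_ne hM hqs.symm hs hq) ?_ ?_ huq ?_ ?_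
  · rwa [isRightDescent_mul_simple_iff cs hM hcomm']
  · rwa [← hc, isRightDescent_mul_simple_iff cs hM hcomm']
  · rw [← hc]
    exact fun h => hus (h.trans (weakLE_mul_simple hqs'))
  · rw [← hc]
    exact hv.weakLE_mul_simple hM hvg hqs' hqt

/-- Every wall separating `g` from `1` lies below a wall which is adjacent to `g`. -/
theorem exists_top_gate (hM : IsRightAngled M) {g v : Γ} (hv : v ∈ wallSet cs g) :
    ∃ s u, cs.IsRightDescent g s ∧ IsGate cs s u ∧ WeakLE cs u g ∧
      ¬ WeakLE cs u (g * cs.simple s) ∧ WeakLE cs v u := by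
  induction g using descent_induction (cs := cs) with
  | h g ih =>
  obtain ⟨⟨t, ht⟩, hvg⟩ := hv
  rcases hvg.eq_or_exists with rfl | ⟨s, hs, hvs⟩
  · exact ⟨t, v, ht.isRightDescent, ht, .refl, not_weakLE_mul_simple ht.isRightDescent, .refl⟩
  obtain ⟨r, w, hr, hw, hws, hwr, hvw⟩ := ih s hs ⟨⟨t, ht⟩, hvs⟩
  obtain ⟨u, ⟨hu, hug, hus⟩, -⟩ := existsUnique_gate hM hs
  by_cases hrg : cs.IsRightDescent g r
  · refine ⟨r, w, hrg, hw, hws.trans (weakLE_mul_simple hs), fun h => hwr ?_, hvw⟩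
    have hrs : r ≠ s := by
      rintro rfl
      rw [cs.isRightDescent_iff_not_isRightDescent_mul] at hrg
      exact hrg hr
    rw [← mul_comm_of_isRightDescent hM hrg hs]
    exact hw.weakLE_mul_simple hM h (isRightDescent_mul_of_ne hM hrs.symm hs hrg) hrs.symm
  · exact ⟨s, u, hs, hu, hug, hus,
      hvw.trans (weakLE_gate_of_not_isRightDescent hM hs hrg hr hug hus hw hws)⟩

/-- Elements with the same walls have the same walls at the top, hence the same right descents. -/
theorem isRightDescent_of_wallSet_eq (hM : IsRightAngled M) {g h : Γ} {s : S}
    (hgh : wallSet cs g = wallSet cs h) (hs : cs.IsRightDescent g s) :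
    cs.IsRightDescent h s ∧ wallSet cs (g * cs.simple s) = wallSet cs (h * cs.simple s) := by
  obtain ⟨u, ⟨hu, hug, hus⟩, -⟩ := existsUnique_gate hM hs
  have hug' : u ∈ wallSet cs g := ⟨⟨s, hu⟩, hug⟩
  obtain ⟨t, v, ht, hv, hvh, hvt, huv⟩ := exists_top_gate hM (hgh ▸ hug')
  have hvg : v ∈ wallSet cs g := hgh ▸ ⟨⟨t, hv⟩, hvh⟩
  -- `u` is maximal among the walls of `g`, hence equal to `v`
  obtain ⟨r, w, hr, hw, hwg, hwr, hvw⟩ := exists_top_gate hM hvg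
  have huw := huv.trans hvw
  have hrs : r = s := by
    by_contra hrs
    exact hus (huw.trans (hw.weakLE_mul_simple hM hwg hs (Ne.symm hrs)))
  subst hrs
  have hwu : w = u := (existsUnique_gate hM hs).unique ⟨hw, hwg, hwr⟩ ⟨hu, hug, hus⟩
  have hvu : v = u := (hwu ▸ hvw).antisymm huv
  subst hvu
  have htr : t = r := hv.unique hu
  subst htr
  refine ⟨ht, ?_⟩
  rw [wallSet_eq_insert hM hs hu hug hus, wallSet_eq_insert hM ht hv hvh hvt] at hgh
  calc wallSet cs (g * cs.simple t)
      = insert v (wallSet cs (g * cs.simple t)) \ {v} := by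
        rw [Set.insert_sdiff_self_of_notMem fun h => hus h.2]
    _ = wallSet cs (h * cs.simple t) := by
        rw [hgh, Set.insert_sdiff_self_of_notMem fun h => hvt h.2]

/-- An element is determined by its walls. -/
theorem wallSet_injective (hM : IsRightAngled M) : Function.Injective (wallSet cs) := by
  intro g
  induction g using descent_induction (cs := cs) with
  | h g ih =>
  intro h hgh
  by_cases hg : g = 1
  · by_contra hne
    subst hg
    obtain ⟨s, hs⟩ := cs.exists_rightDescent_of_ne_one (Ne.symm hne)
    exact cs.not_isRightDescent_one s (isRightDescent_of_wallSet_eq hM hgh.symm hs).1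
  · obtain ⟨s, hs⟩ := cs.exists_rightDescent_of_ne_one hg
    exact mul_right_cancel (ih s hs (isRightDescent_of_wallSet_eq hM hgh hs).2)

/-- Two walls separating `g` from `1` whose types do not commute, or are equal, are nested. -/
theorem weakLE_or_weakLE (hM : IsRightAngled M) {s t : S} {u v g : Γ} (hu : IsGate cs s u)
    (hv : IsGate cs t v) (hug : WeakLE cs u g) (hvg : WeakLE cs v g) (hst : M s t ≠ 2) :
    WeakLE cs u v ∨ WeakLE cs v u := by
  induction g using descent_induction (cs := cs) with
  | h g ih =>
  have key : ∀ {s t : S} {u v : Γ}, IsGate cs s u → IsGate cs t v → WeakLE cs u g →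
      WeakLE cs v g → M s t ≠ 2 → ∀ r, cs.IsRightDescent g r →
      ¬ WeakLE cs u (g * cs.simple r) → WeakLE cs v u ∨
        ∃ q, cs.IsRightDescent g q ∧ WeakLE cs u (g * cs.simple q) ∧
          WeakLE cs v (g * cs.simple q) := by
    intro s t u v hu hv hug hvg hst r hr hur
    have hrs : r = s := by
      by_contra hrs
      exact hur (hu.weakLE_mul_simple hM hug hr hrs)
    subst hrs
    rcases hug.eq_or_exists with rfl | ⟨q, hq, huq⟩
    · exact Or.inl hvg
    have hqr : q ≠ r := fun h => hur (h ▸ huq)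
    refine Or.inr ⟨q, hq, huq, hv.weakLE_mul_simple hM hvg hq ?_⟩
    rintro rfl
    exact hst (comm_of_isRightDescent cs hM hqr.symm hr hq)
  by_cases hg : g = 1
  · subst hg
    have h1 : u ∈ wallSet cs 1 := ⟨⟨s, hu⟩, hug⟩
    rw [wallSet_one] at h1
    exact h1.elim
  obtain ⟨r, hr⟩ := cs.exists_rightDescent_of_ne_one hg
  by_cases hur : WeakLE cs u (g * cs.simple r)
  · by_cases hvr : WeakLE cs v (g * cs.simple r)
    · exact ih r hr hur hvr
    · rcases key hv hu hvg hug (by rwa [M.symmetric]) r hr hvr with h | ⟨q, hq, h1, h2⟩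
      · exact Or.inl h
      · exact ih q hq h2 h1
  · rcases key hu hv hug hvg hst r hr hur with h | ⟨q, hq, h1, h2⟩
    · exact Or.inr h
    · exact ih q hq h1 h2

end WeakOrder

open scoped symmDiff

/-! ### The wall metric and hyperbolicity -/

section WallMetric

variable {S Γ : Type*} [Group Γ] {M : CoxeterMatrix S} (cs : CoxeterSystem M Γ)

/-- The finite set of the walls separating `g` from `1`. -/
noncomputable def walls (hM : IsRightAngled M) (g : Γ) : Finset Γ :=
  (wallSet_finite (cs := cs) hM g).toFinset

variable {cs}

theorem mem_walls (hM : IsRightAngled M) {g u : Γ} :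
    u ∈ walls cs hM g ↔ (∃ s, IsGate cs s u) ∧ WeakLE cs u g := by
  simp [walls, wallSet]

theorem walls_mono (hM : IsRightAngled M) {u g : Γ} (h : WeakLE cs u g) :
    walls cs hM u ⊆ walls cs hM g := fun v hv => by
  rw [mem_walls] at hv ⊢
  exact ⟨hv.1, hv.2.trans h⟩

theorem walls_one (hM : IsRightAngled M) : walls cs hM 1 = ∅ := by
  ext u
  have := Set.ext_iff.1 (wallSet_one (cs := cs)) u
  simpa [walls] using this

theorem walls_injective (hM : IsRightAngled M) : Function.Injective (walls cs hM) := by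
  intro g h hgh
  apply wallSet_injective (cs := cs) hM
  have := congrArg (fun F : Finset Γ => (F : Set Γ)) hgh
  simpa [walls] using this

open Classical in
theorem walls_eq_insert (hM : IsRightAngled M) {s : S} {g u : Γ} (hs : cs.IsRightDescent g s)
    (hu : IsGate cs s u) (hug : WeakLE cs u g) (hus : ¬ WeakLE cs u (g * cs.simple s)) :
    walls cs hM g = insert u (walls cs hM (g * cs.simple s)) := by
  have := wallSet_eq_insert hM hs hu hug hus
  ext v
  have h := Set.ext_iff.1 this v
  simpa [walls] using h

open Classical in
theorem card_symmDiff_walls_mul_simple_le (hM : IsRightAngled M) (g : Γ) (s : S) :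
    (walls cs hM g ∆ walls cs hM (g * cs.simple s)).card ≤ 1 := by
  have key : ∀ g, cs.IsRightDescent g s →
      (walls cs hM g ∆ walls cs hM (g * cs.simple s)).card ≤ 1 := by
    intro g hs
    obtain ⟨u, ⟨hu, hug, hus⟩, -⟩ := existsUnique_gate hM hs
    rw [walls_eq_insert hM hs hu hug hus]
    refine (Finset.card_le_card (t := {u}) fun v hv => ?_).trans (Finset.card_singleton u).le
    rw [Finset.mem_symmDiff, Finset.mem_insert] at hv
    rw [Finset.mem_singleton]
    tauto
  by_cases hs : cs.IsRightDescent g s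
  · exact key g hs
  · have := key (g * cs.simple s) (by
      by_contra h
      exact hs (cs.isRightDescent_iff_not_isRightDescent_mul.2 h))
    rwa [cs.simple_mul_simple_cancel_right, symmDiff_comm] at this

open Classical in
theorem card_symmDiff_walls_le (hM : IsRightAngled M) (g k : Γ) :
    (walls cs hM g ∆ walls cs hM (g * k)).card ≤ cs.length k := by
  induction k using descent_induction (cs := cs) with
  | h k ih =>
  by_cases hk : k = 1
  · simp [hk]
  obtain ⟨s, hs⟩ := cs.exists_rightDescent_of_ne_one hk
  have h1 := ih s hs
  have h2 := card_symmDiff_walls_mul_simple_le (cs := cs) hM (g * (k * cs.simple s)) s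
  rw [mul_assoc, cs.simple_mul_simple_cancel_right] at h2
  have h3 := Finset.card_le_card (symmDiff_triangle (walls cs hM g)
    (walls cs hM (g * (k * cs.simple s))) (walls cs hM (g * k)))
  have h4 := Finset.card_union_le (walls cs hM g ∆ walls cs hM (g * (k * cs.simple s)))
    (walls cs hM (g * (k * cs.simple s)) ∆ walls cs hM (g * k))
  have h5 := cs.isRightDescent_iff.1 hs
  simp only [Finset.sup_eq_union] at h3
  omega

open Classical in
theorem length_le_card_symmDiff_walls (hM : IsRightAngled M) (g h : Γ) :
    cs.length (g⁻¹ * h) ≤ (walls cs hM g ∆ walls cs hM h).card := by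
  induction hn : (walls cs hM g ∆ walls cs hM h).card generalizing g h with
  | zero =>
    rw [Finset.card_eq_zero, ← Finset.bot_eq_empty, symmDiff_eq_bot] at hn
    rw [walls_injective hM hn]
    simp
  | succ n ih =>
    have key : ∀ g h : Γ, (walls cs hM g ∆ walls cs hM h).card = n + 1 →
        (∃ v ∈ walls cs hM g, v ∉ walls cs hM h) → cs.length (g⁻¹ * h) ≤ n + 1 := by
      rintro g h hn ⟨v, hvg, hvh⟩
      rw [mem_walls] at hvg hvh
      obtain ⟨s, u, hs, hu, hug, hus, hvu⟩ := exists_top_gate hM (g := g) hvg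
      have hins := walls_eq_insert hM hs hu hug hus
      have huh : u ∉ walls cs hM h := fun hh =>
        hvh ⟨hvg.1, hvu.trans ((mem_walls hM).1 hh).2⟩
      have hus' : u ∉ walls cs hM (g * cs.simple s) := fun hh => hus ((mem_walls hM).1 hh).2
      have heq : walls cs hM g ∆ walls cs hM h =
          insert u (walls cs hM (g * cs.simple s) ∆ walls cs hM h) := by
        ext w
        rw [hins]
        simp only [Finset.mem_symmDiff, Finset.mem_insert]
        by_cases hw : w = u
        · subst hw
          tauto
        · tauto
      rw [heq, Finset.card_insert_of_notMem (by
        rw [Finset.mem_symmDiff]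
        tauto)] at hn
      have h1 := ih (g * cs.simple s) h (by omega)
      have h2 : g⁻¹ * h = cs.simple s * ((g * cs.simple s)⁻¹ * h) := by
        rw [mul_inv_rev, cs.inv_simple, mul_assoc, cs.simple_mul_simple_cancel_left]
      rw [h2]
      have h3 := cs.length_simple_mul ((g * cs.simple s)⁻¹ * h) s
      omega
    obtain ⟨v, hv⟩ : (walls cs hM g ∆ walls cs hM h).Nonempty := by
      rw [← Finset.card_pos, hn]
      exact n.succ_pos
    rw [Finset.mem_symmDiff] at hv
    rcases hv with hv | hv
    · exact key g h hn ⟨v, hv⟩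
    · have := key h g (by rwa [symmDiff_comm]) ⟨v, hv⟩
      rwa [← cs.length_inv, mul_inv_rev, inv_inv] at this

open Classical in
/-- The distance of two elements is the number of the walls separating them. -/
theorem card_symmDiff_walls (hM : IsRightAngled M) (g h : Γ) :
    (walls cs hM g ∆ walls cs hM h).card = cs.length (g⁻¹ * h) := by
  refine le_antisymm ?_ (length_le_card_symmDiff_walls hM g h)
  have := card_symmDiff_walls_le (cs := cs) hM g (g⁻¹ * h)
  rwa [mul_inv_cancel_left] at this

open Classical in
theorem length_add_two_mul_card_inter_walls (hM : IsRightAngled M) (g h : Γ) :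
    cs.length (g⁻¹ * h) + 2 * (walls cs hM g ∩ walls cs hM h).card =
      (walls cs hM g).card + (walls cs hM h).card := by
  have h1 := Finset.card_sdiff_add_card_inter (walls cs hM g) (walls cs hM h)
  have h2 := Finset.card_sdiff_add_card_inter (walls cs hM h) (walls cs hM g)
  have h3 : (walls cs hM g ∆ walls cs hM h).card =
      (walls cs hM g \ walls cs hM h).card + (walls cs hM h \ walls cs hM g).card := by
    rw [symmDiff_def, Finset.sup_eq_union, Finset.card_union_of_disjoint disjoint_sdiff_sdiff]
  rw [Finset.inter_comm] at h2
  rw [← card_symmDiff_walls hM]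
  omega

theorem length_le_walk_length {g h : Γ} (p : (cayleyGraph cs).Walk g h) :
    cs.length (g⁻¹ * h) ≤ p.length := by
  induction p with
  | nil => simp
  | @cons g k h hadj p ih =>
    have h1 : cs.length (g⁻¹ * k) = 1 := by
      rw [cayleyGraph, SimpleGraph.mulCayley_adj'] at hadj
      obtain ⟨-, _, ⟨s, rfl⟩, rfl | rfl⟩ := hadj
      · simp
      · rw [← cs.length_inv]
        simp
    have h2 := cs.length_mul_le (g⁻¹ * k) (k⁻¹ * h)
    rw [mul_assoc, mul_inv_cancel_left] at h2
    rw [SimpleGraph.Walk.length_cons]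
    omega

theorem dist_mul_le_length (g k : Γ) : (cayleyGraph cs).dist g (g * k) ≤ cs.length k := by
  induction k using descent_induction (cs := cs) with
  | h k ih =>
  by_cases hk : k = 1
  · simp [hk]
  obtain ⟨s, hs⟩ := cs.exists_rightDescent_of_ne_one hk
  have h1 := ih s hs
  have h2 : (cayleyGraph cs).Adj (g * (k * cs.simple s)) (g * k) := by
    rw [cayleyGraph, SimpleGraph.mulCayley_adj']
    refine ⟨fun h => ?_, _, ⟨s, rfl⟩, Or.inl ?_⟩
    · exact cs.length_mul_simple_ne k s (congrArg cs.length (mul_left_cancel h))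
    · rw [mul_assoc, cs.simple_mul_simple_cancel_right]
  have h3 := (cayleyGraph_connected cs).dist_triangle (u := g) (v := g * (k * cs.simple s))
    (w := g * k)
  rw [SimpleGraph.dist_eq_one_iff_adj.2 h2] at h3
  have h4 := cs.isRightDescent_iff.1 hs
  omega

theorem dist_eq_length (g h : Γ) : (cayleyGraph cs).dist g h = cs.length (g⁻¹ * h) := by
  apply le_antisymm
  · have := dist_mul_le_length (cs := cs) g (g⁻¹ * h)
    rwa [mul_inv_cancel_left] at this
  · obtain ⟨p, hp⟩ := (cayleyGraph_connected cs).exists_walk_length_eq_dist g h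
    exact hp ▸ length_le_walk_length p

open Classical in
theorem gromovProduct_eq_card_inter_walls (hM : IsRightAngled M) (g h : Γ) :
    gromovProduct (graphDist (cayleyGraph cs)) 1 g h =
      ((walls cs hM g ∩ walls cs hM h).card : ℝ) := by
  have key : ∀ g, cs.length (g⁻¹ * 1) = (walls cs hM g).card := fun g => by
    rw [← card_symmDiff_walls hM, walls_one, ← Finset.bot_eq_empty, symmDiff_bot]
  have h1 := length_add_two_mul_card_inter_walls (cs := cs) hM g h
  have h2 : (cs.length (g⁻¹ * h) : ℝ) + 2 * ((walls cs hM g ∩ walls cs hM h).card : ℝ) =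
      (walls cs hM g).card + (walls cs hM h).card := by exact_mod_cast h1
  rw [gromovProduct, graphDist, graphDist, graphDist, dist_eq_length, dist_eq_length,
    dist_eq_length, key, key]
  linarith

variable (cs) in
open Classical in
/-- Hyperbolicity with constant `δ`, in terms of walls: a prefix `e` of a geodesic from `1` to `g`
either has at most `δ` walls that do not separate `h` from `1`, or contains up to `δ` walls the
common part of the geodesics from `1` to `g` and to `h`. -/
def IsWallHyperbolic (hM : IsRightAngled M) (δ : ℕ) : Prop :=
  ∀ e g h : Γ, WeakLE cs e g →
    min (walls cs hM e).card (walls cs hM g ∩ walls cs hM h).card ≤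
      (walls cs hM e ∩ walls cs hM h).card + δ

theorem exists_isWallHyperbolic (hM : IsRightAngled M)
    (hyp : IsGromovHyperbolic (graphDist (cayleyGraph cs))) :
    ∃ δ : ℕ, IsWallHyperbolic cs hM δ := by
  classical
  obtain ⟨δ, -, hδ⟩ := hyp
  refine ⟨⌈δ⌉₊, fun e g h he => ?_⟩
  have h1 := hδ 1 e g h
  simp only [gromovProduct_eq_card_inter_walls hM,
    Finset.inter_eq_left.2 (walls_mono hM he)] at h1
  have h2 := Nat.le_ceil δ
  have h3 : (min (walls cs hM e).card (walls cs hM g ∩ walls cs hM h).card : ℝ) ≤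
      (walls cs hM e ∩ walls cs hM h).card + ⌈δ⌉₊ := by linarith
  exact_mod_cast h3

end WallMetric

/-! ### Chains of walls of one colour -/

section ColoredWalls

variable {S Γ κ : Type*} [Group Γ] {M : CoxeterMatrix S} (cs : CoxeterSystem M Γ)

open Classical in
/-- The walls of colour `i` separating `g` from `1`. -/
noncomputable def colorWalls (hM : IsRightAngled M) (c : S → κ) (i : κ) (g : Γ) : Finset Γ :=
  (walls cs hM g).filter fun u => ∃ s, IsGate cs s u ∧ c s = i

variable {cs}

theorem mem_colorWalls (hM : IsRightAngled M) {c : S → κ} {i : κ} {g u : Γ} :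
    u ∈ colorWalls cs hM c i g ↔ (∃ s, IsGate cs s u ∧ c s = i) ∧ WeakLE cs u g := by
  classical
  rw [colorWalls, Finset.mem_filter, mem_walls]
  constructor
  · rintro ⟨⟨-, h⟩, h'⟩
    exact ⟨h', h⟩
  · rintro ⟨⟨s, hs, hc⟩, h⟩
    exact ⟨⟨⟨s, hs⟩, h⟩, s, hs, hc⟩

theorem colorWalls_subset_walls (hM : IsRightAngled M) (c : S → κ) (i : κ) (g : Γ) :
    colorWalls cs hM c i g ⊆ walls cs hM g := by
  intro u hu
  obtain ⟨⟨s, hs, -⟩, h⟩ := (mem_colorWalls hM).1 hu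
  exact (mem_walls hM).2 ⟨⟨s, hs⟩, h⟩

theorem colorWalls_mono (hM : IsRightAngled M) (c : S → κ) (i : κ) {u g : Γ}
    (h : WeakLE cs u g) : colorWalls cs hM c i u ⊆ colorWalls cs hM c i g := fun v hv => by
  rw [mem_colorWalls] at hv ⊢
  exact ⟨hv.1, hv.2.trans h⟩

theorem self_mem_colorWalls (hM : IsRightAngled M) {c : S → κ} {i : κ} {g u : Γ}
    (hu : u ∈ colorWalls cs hM c i g) : u ∈ colorWalls cs hM c i u := by
  rw [mem_colorWalls] at hu ⊢
  exact ⟨hu.1, .refl⟩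

theorem colorWalls_subset_of_mem (hM : IsRightAngled M) {c : S → κ} {i : κ} {g u : Γ}
    (hu : u ∈ colorWalls cs hM c i g) : colorWalls cs hM c i u ⊆ colorWalls cs hM c i g :=
  colorWalls_mono hM c i ((mem_colorWalls hM).1 hu).2

theorem card_colorWalls_self_pos (hM : IsRightAngled M) {c : S → κ} {i : κ} {g u : Γ}
    (hu : u ∈ colorWalls cs hM c i g) : 0 < (colorWalls cs hM c i u).card :=
  Finset.card_pos.2 ⟨u, self_mem_colorWalls hM hu⟩

theorem disjoint_colorWalls (hM : IsRightAngled M) (c : S → κ) {i j : κ} (hij : i ≠ j) (g h : Γ) :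
    Disjoint (colorWalls cs hM c i g) (colorWalls cs hM c j h) := by
  rw [Finset.disjoint_left]
  intro u hu hu'
  obtain ⟨⟨s, hs, rfl⟩, -⟩ := (mem_colorWalls hM).1 hu
  obtain ⟨⟨t, ht, rfl⟩, -⟩ := (mem_colorWalls hM).1 hu'
  exact hij (congrArg c (hs.unique ht))

theorem exists_mem_colorWalls (hM : IsRightAngled M) (c : S → κ) {g u : Γ}
    (hu : u ∈ walls cs hM g) : ∃ i, u ∈ colorWalls cs hM c i g := by
  obtain ⟨⟨s, hs⟩, h⟩ := (mem_walls hM).1 hu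
  exact ⟨c s, (mem_colorWalls hM).2 ⟨⟨s, hs, rfl⟩, h⟩⟩

theorem sum_card_colorWalls [Fintype κ] (hM : IsRightAngled M) (c : S → κ) (g : Γ) :
    ∑ i, (colorWalls cs hM c i g).card = (walls cs hM g).card := by
  classical
  rw [← Finset.card_biUnion fun i _ j _ hij => disjoint_colorWalls hM c hij g g]
  congr 1
  ext u
  rw [Finset.mem_biUnion]
  constructor
  · rintro ⟨i, -, hu⟩
    exact colorWalls_subset_walls hM c i g hu
  · intro hu
    obtain ⟨i, hi⟩ := exists_mem_colorWalls hM c hu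
    exact ⟨i, Finset.mem_univ i, hi⟩

open Classical in
theorem sum_card_colorWalls_inter [Fintype κ] (hM : IsRightAngled M) (c : S → κ) (g h : Γ) :
    ∑ i, (colorWalls cs hM c i g ∩ colorWalls cs hM c i h).card =
      (walls cs hM g ∩ walls cs hM h).card := by
  rw [← Finset.card_biUnion fun i _ j _ hij => (disjoint_colorWalls hM c hij g g).mono
    Finset.inter_subset_left Finset.inter_subset_left]
  congr 1
  ext u
  rw [Finset.mem_biUnion, Finset.mem_inter]
  constructor
  · rintro ⟨i, -, hu⟩
    rw [Finset.mem_inter] at hu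
    exact ⟨colorWalls_subset_walls hM c i g hu.1, colorWalls_subset_walls hM c i h hu.2⟩
  · rintro ⟨hu, hu'⟩
    obtain ⟨i, hi⟩ := exists_mem_colorWalls hM c hu
    refine ⟨i, Finset.mem_univ i, Finset.mem_inter.2 ⟨hi, ?_⟩⟩
    exact (mem_colorWalls hM).2 ⟨((mem_colorWalls hM).1 hi).1, ((mem_walls hM).1 hu').2⟩

/-- If commuting generators have different colours, then the walls of one colour separating `g`
from `1` form a chain. -/
theorem weakLE_or_weakLE_of_mem_colorWalls (hM : IsRightAngled M) {c : S → κ}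
    (hc : ∀ s t, M s t = 2 → c s ≠ c t) {i : κ} {g u v : Γ}
    (hu : u ∈ colorWalls cs hM c i g) (hv : v ∈ colorWalls cs hM c i g) :
    WeakLE cs u v ∨ WeakLE cs v u := by
  obtain ⟨⟨s, hs, rfl⟩, hug⟩ := (mem_colorWalls hM).1 hu
  obtain ⟨⟨t, ht, hst⟩, hvg⟩ := (mem_colorWalls hM).1 hv
  exact weakLE_or_weakLE hM hs ht hug hvg fun h => hc s t h hst.symm

theorem eq_of_card_colorWalls_eq (hM : IsRightAngled M) {c : S → κ}
    (hc : ∀ s t, M s t = 2 → c s ≠ c t) {i : κ} {g u v : Γ}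
    (hu : u ∈ colorWalls cs hM c i g) (hv : v ∈ colorWalls cs hM c i g)
    (h : (colorWalls cs hM c i u).card = (colorWalls cs hM c i v).card) : u = v := by
  have key : ∀ {u v}, u ∈ colorWalls cs hM c i g → v ∈ colorWalls cs hM c i g →
      (colorWalls cs hM c i u).card = (colorWalls cs hM c i v).card → WeakLE cs u v → u = v := by
    intro u v hu hv h huv
    have h1 := Finset.eq_of_subset_of_card_le (colorWalls_mono hM c i huv) h.ge
    have h2 := self_mem_colorWalls hM hv
    rw [← h1] at h2
    exact huv.antisymm ((mem_colorWalls hM).1 h2).2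
  rcases weakLE_or_weakLE_of_mem_colorWalls hM hc hu hv with huv | hvu
  · exact key hu hv h huv
  · exact (key hv hu h.symm hvu).symm

/-- The rank of a wall `u` of colour `i` is the number of walls of colour `i` up to `u` itself. A set
of walls of one colour separating `g` from `1` which is closed under passing to lower walls contains
walls of all ranks up to its cardinality. -/
theorem exists_mem_of_lt_card (hM : IsRightAngled M) {c : S → κ}
    (hc : ∀ s t, M s t = 2 → c s ≠ c t) {i : κ} {g : Γ} {F : Finset Γ}
    (hF : F ⊆ colorWalls cs hM c i g) (hF' : ∀ u ∈ F, colorWalls cs hM c i u ⊆ F) {k : ℕ}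
    (hk : k < F.card) : ∃ u ∈ F, (colorWalls cs hM c i u).card = k + 1 := by
  have h := Finset.surj_on_of_inj_on_of_card_le (s := F) (t := Finset.Icc 1 F.card)
    (fun u _ => (colorWalls cs hM c i u).card)
    (fun u hu => Finset.mem_Icc.2
      ⟨card_colorWalls_self_pos hM (hF hu), Finset.card_le_card (hF' u hu)⟩)
    (fun u v hu hv huv => eq_of_card_colorWalls_eq hM hc (hF hu) (hF hv) huv)
    (by simp) (k + 1) (Finset.mem_Icc.2 ⟨by omega, hk⟩)
  obtain ⟨u, hu, h⟩ := h
  exact ⟨u, hu, h.symm⟩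

variable (cs) in
open Classical in
/-- The `k`-th wall of colour `i` on the way from `1` to `g`, counted from `0`; the junk value `1`
if there are at most `k` of them. -/
noncomputable def nthWall (hM : IsRightAngled M) (c : S → κ) (i : κ) (g : Γ) (k : ℕ) : Γ :=
  if h : ∃ u ∈ colorWalls cs hM c i g, (colorWalls cs hM c i u).card = k + 1 then h.choose else 1

theorem nthWall_spec (hM : IsRightAngled M) {c : S → κ}
    (hc : ∀ s t, M s t = 2 → c s ≠ c t) {i : κ} {g : Γ} {k : ℕ}
    (hk : k < (colorWalls cs hM c i g).card) :
    nthWall cs hM c i g k ∈ colorWalls cs hM c i g ∧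
      (colorWalls cs hM c i (nthWall cs hM c i g k)).card = k + 1 := by
  have h := exists_mem_of_lt_card hM hc (subset_refl _)
    (fun u hu => colorWalls_subset_of_mem hM hu) hk
  rw [nthWall, dif_pos h]
  exact h.choose_spec

open Classical in
theorem nthWall_eq_of_lt_card_inter (hM : IsRightAngled M) {c : S → κ}
    (hc : ∀ s t, M s t = 2 → c s ≠ c t) {i : κ} {g h : Γ} {k : ℕ}
    (hk : k < (colorWalls cs hM c i g ∩ colorWalls cs hM c i h).card) :
    nthWall cs hM c i g k = nthWall cs hM c i h k := by
  obtain ⟨u, hu, huk⟩ := exists_mem_of_lt_card hM hc Finset.inter_subset_left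
    (fun u hu => Finset.subset_inter
      (colorWalls_subset_of_mem hM (Finset.mem_inter.1 hu).1)
      (colorWalls_subset_of_mem hM (Finset.mem_inter.1 hu).2)) hk
  obtain ⟨hug, huh⟩ := Finset.mem_inter.1 hu
  have h1 := nthWall_spec hM hc (hk.trans_le (Finset.card_le_card Finset.inter_subset_left))
  have h2 := nthWall_spec hM hc (hk.trans_le (Finset.card_le_card Finset.inter_subset_right))
  rw [eq_of_card_colorWalls_eq hM hc h1.1 hug (h1.2.trans huk.symm),
    eq_of_card_colorWalls_eq hM hc h2.1 huh (h2.2.trans huk.symm)]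

open Classical in
theorem nthWall_notMem (hM : IsRightAngled M) {c : S → κ}
    (hc : ∀ s t, M s t = 2 → c s ≠ c t) {i : κ} {g h : Γ} {k : ℕ}
    (hk : (colorWalls cs hM c i g ∩ colorWalls cs hM c i h).card ≤ k)
    (hk' : k < (colorWalls cs hM c i g).card) :
    nthWall cs hM c i g k ∉ walls cs hM h := by
  intro hmem
  obtain ⟨h1, h2⟩ := nthWall_spec hM hc hk'
  have h3 := Finset.card_le_card (Finset.subset_inter (colorWalls_subset_of_mem hM h1)
    (colorWalls_mono hM c i ((mem_walls hM).1 hmem).2))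
  omega

open Classical in
/-- In a hyperbolic group, every wall between `g` and the branch point of the geodesics from `1` to
`g` and to `h` is reached, on the way from `1`, at a point close to `g`: only the first few walls of
each colour behind the branch point make an exception. -/
theorem length_nthWall_inv_mul_le (hM : IsRightAngled M) {c : S → κ}
    (hc : ∀ s t, M s t = 2 → c s ≠ c t) {δ : ℕ}
    (hδ : IsWallHyperbolic cs hM δ) {i : κ} {g h : Γ} {k : ℕ}
    (hk : (colorWalls cs hM c i g ∩ colorWalls cs hM c i h).card + δ ≤ k)
    (hk' : k < (colorWalls cs hM c i g).card) :
    cs.length ((nthWall cs hM c i g k)⁻¹ * g) ≤ cs.length (g⁻¹ * h) + δ := by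
  obtain ⟨h1, h2⟩ := nthWall_spec hM hc hk'
  set e := nthWall cs hM c i g k
  have heg : WeakLE cs e g := ((mem_colorWalls hM).1 h1).2
  have hsub := walls_mono hM heg
  have h3 := hδ e g h heg
  have hleft : (colorWalls cs hM c i e ∩ colorWalls cs hM c i h).card ≤
      (colorWalls cs hM c i g ∩ colorWalls cs hM c i h).card :=
    Finset.card_le_card (Finset.inter_subset_inter_right (colorWalls_mono hM c i heg))
  have h4 := Finset.card_sdiff_add_card_inter (colorWalls cs hM c i e) (colorWalls cs hM c i h)
  have h5 := Finset.card_sdiff_add_card_inter (walls cs hM e) (walls cs hM h)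
  have h6 : (colorWalls cs hM c i e \ colorWalls cs hM c i h).card ≤
      (walls cs hM e \ walls cs hM h).card := by
    refine Finset.card_le_card fun u hu => ?_
    rw [Finset.mem_sdiff] at hu ⊢
    refine ⟨colorWalls_subset_walls hM c i e hu.1, fun h' => hu.2 ?_⟩
    exact (mem_colorWalls hM).2 ⟨((mem_colorWalls hM).1 hu.1).1, ((mem_walls hM).1 h').2⟩
  have h7 := length_add_two_mul_card_inter_walls (cs := cs) hM e g
  rw [Finset.inter_eq_left.2 hsub] at h7
  have h8 := length_add_two_mul_card_inter_walls (cs := cs) hM g h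
  have h9 := Finset.card_le_card
    (Finset.inter_subset_right (s₁ := walls cs hM g) (s₂ := walls cs hM h))
  have h10 := Finset.card_le_card
    (Finset.inter_subset_left (s₁ := walls cs hM e) (s₂ := walls cs hM h))
  omega

end ColoredWalls

/-! ### Growth of balls -/

section Counting

variable {S Γ : Type*} [Group Γ] {M : CoxeterMatrix S} (cs : CoxeterSystem M Γ)

theorem finite_ncard_length_le [Finite S] (r : ℕ) : {g : Γ | cs.length g ≤ r}.Finite ∧
    {g : Γ | cs.length g ≤ r}.ncard ≤ (Nat.card S + 1) ^ r := by
  induction r with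
  | zero =>
    have : {g : Γ | cs.length g ≤ 0} = {1} := by
      ext g
      simp
    rw [this]
    simp
  | succ r ih =>
    have hsub : {g : Γ | cs.length g ≤ r + 1} ⊆
        (fun p : Γ × Option S => p.1 * p.2.elim 1 cs.simple) ''
          ({g : Γ | cs.length g ≤ r} ×ˢ Set.univ) := by
      intro g hg
      by_cases h1 : g = 1
      · exact ⟨(1, none), ⟨by simp, trivial⟩, by simp [h1]⟩
      · obtain ⟨s, hs⟩ := cs.exists_rightDescent_of_ne_one h1
        refine ⟨(g * cs.simple s, some s), ⟨?_, trivial⟩, by simp⟩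
        have h2 := cs.isRightDescent_iff.1 hs
        simp only [Set.mem_ofPred_eq] at hg ⊢
        omega
    have hfin := (ih.1.prod (Set.finite_univ (α := Option S))).image
      (fun p : Γ × Option S => p.1 * p.2.elim 1 cs.simple)
    refine ⟨hfin.subset hsub, (Set.ncard_le_ncard hsub hfin).trans ?_⟩
    refine (Set.ncard_image_le (ih.1.prod Set.finite_univ)).trans ?_
    rw [Set.ncard_prod, Set.ncard_univ, Finite.card_option, pow_succ]
    exact Nat.mul_le_mul_right _ ih.2

end Counting

/-! ### Distances in rooted trees -/

section Trees

theorem exists_prefix_of_walk {Ω : Type*} {x y : List Ω} (w : (rootedTree Ω).Walk x y) :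
    ∃ p, p <+: x ∧ p <+: y ∧ x.length + y.length ≤ w.length + 2 * p.length := by
  induction w with
  | @nil u => exact ⟨u, List.prefix_rfl, List.prefix_rfl, by simp; omega⟩
  | @cons x z y hadj w ih =>
    obtain ⟨p, hpz, hpy, hlen⟩ := ih
    rw [SimpleGraph.Walk.length_cons]
    rcases hadj with ⟨a, rfl⟩ | ⟨a, rfl⟩
    · rw [List.length_append, List.length_singleton] at hlen
      rcases List.prefix_concat_iff.1 hpz with rfl | hpx
      · exact ⟨x, List.prefix_rfl, (List.prefix_append x [a]).trans hpy, by
          simp at hlen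
          omega⟩
      · exact ⟨p, hpx, hpy, by omega⟩
    · refine ⟨p, hpz.trans (List.prefix_append z [a]), hpy, ?_⟩
      rw [List.length_append, List.length_singleton]
      omega

/-- A geodesic in a rooted tree passes through a common prefix of its ends. -/
theorem exists_prefix_length_add_length_le {Ω : Type*} (x y : List Ω) :
    ∃ p, p <+: x ∧ p <+: y ∧
      x.length + y.length ≤ (rootedTree Ω).dist x y + 2 * p.length := by
  obtain ⟨w, hw⟩ := (rootedTree_connected Ω).exists_walk_length_eq_dist x y
  exact hw ▸ exists_prefix_of_walk w

theorem dist_append_le {Ω : Type*} (p x : List Ω) :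
    (rootedTree Ω).dist p (p ++ x) ≤ x.length := by
  induction x using List.reverseRecOn with
  | nil => simp
  | append_singleton x a ih =>
    have h : (rootedTree Ω).Adj (p ++ x) (p ++ (x ++ [a])) := Or.inl ⟨a, by simp⟩
    have h1 := (rootedTree_connected Ω).dist_triangle (u := p) (v := p ++ x)
      (w := p ++ (x ++ [a]))
    rw [SimpleGraph.dist_eq_one_iff_adj.2 h] at h1
    rw [List.length_append, List.length_singleton]
    omega

theorem dist_add_two_mul_length_le {Ω : Type*} {p x y : List Ω} (hx : p <+: x) (hy : p <+: y) :
    (rootedTree Ω).dist x y + 2 * p.length ≤ x.length + y.length := by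
  obtain ⟨x, rfl⟩ := hx
  obtain ⟨y, rfl⟩ := hy
  have h1 := (rootedTree_connected Ω).dist_triangle (u := p ++ x) (v := p) (w := p ++ y)
  have h2 := dist_append_le p x
  have h3 := dist_append_le p y
  rw [SimpleGraph.dist_comm] at h2
  simp only [List.length_append]
  omega

/-- The concatenation of the first `N` terms of a sequence of words of length `m`. -/
def concatBlocks {Ω : Type*} (m : ℕ) [NeZero m] (f : ℕ → Fin m → Ω) (N : ℕ) : List Ω :=
  (List.range (m * N)).map fun k => f (k / m) (Fin.ofNat m k)

section Blocks

variable {Ω : Type*} {m : ℕ} [NeZero m] {f g : ℕ → Fin m → Ω}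

theorem length_concatBlocks (N : ℕ) : (concatBlocks m f N).length = m * N := by
  simp [concatBlocks]

theorem concatBlocks_prefix {b N : ℕ} (hb : b ≤ N) :
    concatBlocks m f b <+: concatBlocks m f N := by
  refine List.IsPrefix.map _ ?_
  obtain ⟨k, hk⟩ := Nat.exists_eq_add_of_le (Nat.mul_le_mul_left m hb)
  rw [hk, List.range_add]
  exact List.prefix_append _ _

theorem concatBlocks_congr {N : ℕ} (h : ∀ k < N, f k = g k) :
    concatBlocks m f N = concatBlocks m g N := by
  refine List.map_congr_left fun k hk => ?_
  rw [List.mem_range] at hk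
  rw [h _ (Nat.div_lt_of_lt_mul hk)]

theorem eq_of_prefix_concatBlocks {p : List Ω} {N N' : ℕ} (hp : p <+: concatBlocks m f N)
    (hp' : p <+: concatBlocks m g N') {k : ℕ} (hk : k < p.length / m) : f k = g k := by
  have hm : 0 < m := Nat.pos_of_neZero m
  funext j
  have hlt : m * k + j < p.length := by
    have h1 := Nat.mul_le_mul_left m (Nat.succ_le_of_lt hk)
    have h2 := Nat.mul_div_le p.length m
    have h3 := j.2
    rw [Nat.mul_succ] at h1
    omega
  have h1 := List.IsPrefix.getElem hp hlt
  have h2 := List.IsPrefix.getElem hp' hlt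
  have hdiv : (m * k + j) / m = k := by
    rw [Nat.mul_add_div hm, Nat.div_eq_of_lt j.2, add_zero]
  have hmod : Fin.ofNat m (m * k + j) = j := by
    apply Fin.ext
    simp [Fin.ofNat, Nat.mod_eq_of_lt j.2]
  rw [h1] at h2
  simpa only [concatBlocks, List.getElem_map, List.getElem_range, hdiv, hmod] using h2

end Blocks
end Trees

/-! ### Labelings avoiding a sparse system of conflicts -/

section Labelings

/-- A family of conflicts on a set `V` to be labelled. The conflict `e` consists of the pairs
`(left e i, right e i)` for `i ∈ idx e`, which are pairwise disjoint; a labeling has to give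
different labels to the two members of at least one of these pairs. -/
structure ConflictSystem (ι κ V : Type*) where
  /-- The indices of the pairs of a conflict. -/
  idx : ι → Finset κ
  /-- The first members of the pairs. -/
  left : ι → κ → V
  /-- The second members of the pairs. -/
  right : ι → κ → V
  left_injOn : ∀ e, Set.InjOn (left e) (idx e)
  right_injOn : ∀ e, Set.InjOn (right e) (idx e)
  left_ne_right : ∀ e, ∀ i ∈ idx e, ∀ j ∈ idx e, left e i ≠ right e j
  two_le_card : ∀ e, 2 ≤ (idx e).card

namespace ConflictSystem

variable {ι κ V Ω : Type*} (P : ConflictSystem ι κ V)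

/-- The labeling `l` violates the conflict `e`. -/
def Violates (l : V → Ω) (e : ι) : Prop := ∀ i ∈ P.idx e, l (P.left e i) = l (P.right e i)

/-- All the elements occurring in the conflict `e` belong to `X`. -/
def Within (e : ι) (X : Finset V) : Prop := ∀ i ∈ P.idx e, P.left e i ∈ X ∧ P.right e i ∈ X

/-- The element `w` occurs in the conflict `e`. -/
def Involves (e : ι) (w : V) : Prop := ∃ i ∈ P.idx e, P.left e i = w ∨ P.right e i = w

/-- The labelings of `X`, extended by the constant `o`, that violate no conflict within `X`. -/
def goodOn (o : Ω) (X : Finset V) : Set (V → Ω) :=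
  {l | (∀ v ∉ X, l v = o) ∧ ∀ e, P.Within e X → ¬ P.Violates l e}

variable {P}

theorem finite_supportedOn [Finite Ω] (o : Ω) (X : Finset V) :
    {l : V → Ω | ∀ v ∉ X, l v = o}.Finite := by
  refine Set.Finite.of_injOn (f := fun l (x : X) => l x) (t := Set.univ)
    (fun _ _ => Set.mem_univ _) ?_ Set.finite_univ
  intro l hl l' hl' h
  funext v
  by_cases hv : v ∈ X
  · exact congrFun h ⟨v, hv⟩
  · rw [hl v hv, hl' v hv]

theorem finite_goodOn [Finite Ω] (o : Ω) (X : Finset V) : (P.goodOn o X).Finite :=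
  (finite_supportedOn o X).subset fun _ hl => hl.1

open Classical in
/-- Adding the elements of `X \ Y` to `Y` one by one multiplies the number of good labelings each
time by at least `β`. -/
theorem pow_mul_ncard_goodOn_le {β : ℕ} {o : Ω} {X : Finset V}
    (ih : ∀ Y ⊂ X, ∀ v ∉ Y, β * (P.goodOn o Y).ncard ≤ (P.goodOn o (insert v Y)).ncard)
    {Y : Finset V} (hY : Y ⊆ X) :
    β ^ (X \ Y).card * (P.goodOn o Y).ncard ≤ (P.goodOn o X).ncard := by
  induction hm : (X \ Y).card generalizing Y with
  | zero =>
    rw [Finset.card_eq_zero, Finset.sdiff_eq_empty_iff_subset] at hm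
    rw [hY.antisymm hm]
    simp
  | succ m IH =>
    obtain ⟨v, hv⟩ : (X \ Y).Nonempty := Finset.card_pos.1 (by omega)
    obtain ⟨hvX, hvY⟩ := Finset.mem_sdiff.1 hv
    have h1 := ih Y ⟨hY, fun h => hvY (h hvX)⟩ v hvY
    have h2 : insert v Y ⊆ X := Finset.insert_subset hvX hY
    have h3 : (X \ insert v Y).card = m := by
      have h4 : X \ insert v Y = (X \ Y).erase v := by
        ext x
        simp only [Finset.mem_sdiff, Finset.mem_insert, Finset.mem_erase]
        tauto
      rw [h4, Finset.card_erase_of_mem hv, hm, Nat.add_sub_cancel]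
    calc β ^ (m + 1) * (P.goodOn o Y).ncard = β ^ m * (β * (P.goodOn o Y).ncard) := by ring
      _ ≤ β ^ m * (P.goodOn o (insert v Y)).ncard := Nat.mul_le_mul_left _ h1
      _ ≤ _ := IH h2 h3

open Classical in
/-- The extensions to `insert w X` of the good labelings of `X`. -/
def extensions (P : ConflictSystem ι κ V) (o : Ω) (X : Finset V) (w : V) : Set (V → Ω) :=
  {l | (∀ v ∉ insert w X, l v = o) ∧ Function.update l w o ∈ P.goodOn o X}

theorem finite_extensions [Finite Ω] (o : Ω) (X : Finset V) (w : V) :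
    (P.extensions o X w).Finite := by
  classical
  exact (finite_supportedOn o (insert w X)).subset fun _ hl => hl.1

theorem card_mul_ncard_goodOn_le [Finite Ω] (o : Ω) {X : Finset V} {w : V} (hw : w ∉ X) :
    Nat.card Ω * (P.goodOn o X).ncard ≤ (P.extensions o X w).ncard := by
  classical
  have hinj : Set.InjOn (fun p : Ω × (V → Ω) => Function.update p.2 w p.1)
      (Set.univ ×ˢ P.goodOn o X) := by
    rintro ⟨a, l⟩ ⟨-, hl⟩ ⟨b, l'⟩ ⟨-, hl'⟩ h
    have h1 := congrFun h w
    simp only [Function.update_self] at h1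
    refine Prod.ext h1 (funext fun v => ?_)
    by_cases hv : v = w
    · subst hv
      exact (hl.1 v hw).trans (hl'.1 v hw).symm
    · simpa [hv] using congrFun h v
  rw [← Set.ncard_univ, ← Set.ncard_prod, ← hinj.ncard_image]
  refine Set.ncard_le_ncard ?_ (finite_extensions o X w)
  rintro _ ⟨⟨a, l⟩, ⟨-, hl⟩, rfl⟩
  refine ⟨fun v hv => ?_, ?_⟩
  · rw [Finset.mem_insert, not_or] at hv
    exact (Function.update_of_ne hv.1 a l).trans (hl.1 v hv.2)
  · have : Function.update (Function.update l w a) w o = l := by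
      rw [Function.update_idem, ← hl.1 w hw, Function.update_eq_self]
    simpa only [this] using hl

open Classical in
/-- If the labels on `H` can be recovered from the others in a labeling violating `e`, then the
extensions violating `e` are not more than the good labelings of `X \ H`. -/
theorem ncard_violating_le [Finite Ω] {o : Ω} {X H : Finset V} {w : V} {e : ι} (hw : w ∉ X)
    (hwH : w ∈ H) (hrec : ∀ l l' : V → Ω, P.Violates l e → P.Violates l' e →
      (∀ v ∉ H, l v = l' v) → l = l') :
    {l ∈ P.extensions o X w | P.Violates l e}.ncard ≤ (P.goodOn o (X \ H)).ncard := by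
  refine Set.ncard_le_ncard_of_injOn (fun l v => if v ∈ H then o else l v) ?_ ?_
    (finite_goodOn o _)
  · rintro l ⟨⟨hl, hl'⟩, -⟩
    refine ⟨fun v hv => ?_, fun f hf hviol => ?_⟩
    · by_cases hvH : v ∈ H
      · simp [hvH]
      · have hvw : v ≠ w := fun h => hvH (h ▸ hwH)
        have hvX : v ∉ X := fun h => hv (Finset.mem_sdiff.2 ⟨h, hvH⟩)
        simp only [hvH, if_false]
        exact hl v (by simp [hvw, hvX])
    · refine hl'.2 f (fun i hi => ⟨(Finset.mem_sdiff.1 (hf i hi).1).1,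
        (Finset.mem_sdiff.1 (hf i hi).2).1⟩) fun i hi => ?_
      have h1 := hviol i hi
      obtain ⟨ha, hb⟩ := hf i hi
      rw [Finset.mem_sdiff] at ha hb
      have haw : P.left f i ≠ w := fun h => hw (h ▸ ha.1)
      have hbw : P.right f i ≠ w := fun h => hw (h ▸ hb.1)
      simpa [ha.2, hb.2, haw, hbw] using h1
  · rintro l ⟨-, hl⟩ l' ⟨-, hl'⟩ h
    refine hrec l l' hl hl' fun v hv => ?_
    simpa [hv] using congrFun h v

open Classical in
/-- In an extension violating `e` the labels on one side of `e` are those on the other side. So the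
side of `e` containing `w` can be deleted without loss of information; besides `w`, it consists of
`(P.idx e).card - 1` elements of `X`. -/
theorem ncard_violating_mul_le [Finite Ω] {β : ℕ} {o : Ω} {X : Finset V} {w : V} {e : ι}
    (hw : w ∉ X) (he : P.Involves e w) (heX : P.Within e (insert w X))
    (ih : ∀ Y ⊂ X, ∀ v ∉ Y, β * (P.goodOn o Y).ncard ≤ (P.goodOn o (insert v Y)).ncard) :
    {l ∈ P.extensions o X w | P.Violates l e}.ncard * β ^ ((P.idx e).card - 1) ≤
      (P.goodOn o X).ncard := by
  have key : ∀ H : Finset V, w ∈ H → H ⊆ insert w X → H.card = (P.idx e).card →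
      (∀ l l' : V → Ω, P.Violates l e → P.Violates l' e → (∀ v ∉ H, l v = l' v) → l = l') →
      {l ∈ P.extensions o X w | P.Violates l e}.ncard * β ^ ((P.idx e).card - 1) ≤
      (P.goodOn o X).ncard := by
    intro H hwH hH hcard hrec
    have h1 := ncard_violating_le (o := o) hw hwH hrec
    have h2 := pow_mul_ncard_goodOn_le ih (Finset.sdiff_subset (s := X) (t := H))
    have h3 : X \ (X \ H) = H.erase w := by
      ext v
      rw [Finset.mem_sdiff, Finset.mem_sdiff, Finset.mem_erase]
      constructor
      · rintro ⟨hv, hv'⟩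
        exact ⟨fun h => hw (h ▸ hv), by tauto⟩
      · rintro ⟨hvw, hv⟩
        have h := hH hv
        rw [Finset.mem_insert] at h
        tauto
    rw [h3, Finset.card_erase_of_mem hwH, hcard] at h2
    rw [mul_comm]
    exact (Nat.mul_le_mul_left _ h1).trans h2
  obtain ⟨i, hi, hiw | hiw⟩ := he
  · refine key ((P.idx e).image (P.left e)) (Finset.mem_image.2 ⟨i, hi, hiw⟩) ?_
      (Finset.card_image_of_injOn (P.left_injOn e)) fun l l' hl hl' h => funext fun v => ?_
    · exact Finset.image_subset_iff.2 fun j hj => (heX j hj).1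
    · by_cases hv : v ∈ (P.idx e).image (P.left e)
      · obtain ⟨j, hj, rfl⟩ := Finset.mem_image.1 hv
        rw [hl j hj, hl' j hj]
        refine h _ fun hmem => ?_
        obtain ⟨j', hj', h'⟩ := Finset.mem_image.1 hmem
        exact P.left_ne_right e j' hj' j hj h'
      · exact h v hv
  · refine key ((P.idx e).image (P.right e)) (Finset.mem_image.2 ⟨i, hi, hiw⟩) ?_
      (Finset.card_image_of_injOn (P.right_injOn e)) fun l l' hl hl' h => funext fun v => ?_
    · exact Finset.image_subset_iff.2 fun j hj => (heX j hj).2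
    · by_cases hv : v ∈ (P.idx e).image (P.right e)
      · obtain ⟨j, hj, rfl⟩ := Finset.mem_image.1 hv
        rw [← hl j hj, ← hl' j hj]
        refine h _ fun hmem => ?_
        obtain ⟨j', hj', h'⟩ := Finset.mem_image.1 hmem
        exact P.left_ne_right e j hj j' hj' h'.symm
      · exact h v hv

/-- There are at most `A ^ k` conflicts with `k` pairs in which a given element occurs. -/
def IsSparse (P : ConflictSystem ι κ V) (A : ℕ) : Prop :=
  ∀ w k, {e | (P.idx e).card = k ∧ P.Involves e w}.Finite ∧
    {e | (P.idx e).card = k ∧ P.Involves e w}.ncard ≤ A ^ k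

open Classical in
/-- One more element `w` multiplies the number `G` of good labelings by at least `2 * A ^ 2`. There
are at least `4 * A ^ 2 * G` extensions; by induction, a conflict with `k` pairs is violated by at
most `G / (2 * A ^ 2) ^ (k - 1)` of them, and `w` occurs in at most `A ^ k` such conflicts, so that
in total at most `G` extensions violate a conflict. -/
theorem mul_ncard_goodOn_le_ncard_goodOn_insert [Finite Ω] {A : ℕ} (hA : 1 ≤ A)
    (hP : P.IsSparse A) (hΩ : 4 * A ^ 2 ≤ Nat.card Ω) (o : Ω) (X : Finset V) :
    ∀ w ∉ X, 2 * A ^ 2 * (P.goodOn o X).ncard ≤ (P.goodOn o (insert w X)).ncard := by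
  induction X using Finset.strongInduction with
  | H X ih =>
  intro w hw
  set G := (P.goodOn o X).ncard with hG
  set G' := (P.goodOn o (insert w X)).ncard with hG'
  let E := (finite_extensions (P := P) o X w).toFinset
  let T : ℕ → Finset ι := fun k => (hP w k).1.toFinset.filter fun e => P.Within e (insert w X)
  let B : ι → Finset (V → Ω) := fun e => E.filter fun l => P.Violates l e
  let U := (Finset.range (insert w X).card).biUnion fun j => (T (j + 2)).biUnion B
  have hTcard : ∀ k, (T k).card ≤ A ^ k := fun k =>
    (Finset.card_filter_le _ _).trans (by
      rw [← Set.ncard_eq_toFinset_card _ (hP w k).1]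
      exact (hP w k).2)
  have hT : ∀ k e, e ∈ T k ↔ ((P.idx e).card = k ∧ P.Involves e w) ∧
      P.Within e (insert w X) := by
    intro k e
    simp [T]
  have hB : ∀ k e, e ∈ T k → (B e).card * (2 * A ^ 2) ^ (k - 1) ≤ G := by
    intro k e he
    obtain ⟨⟨hk, hew⟩, hwith⟩ := (hT k e).1 he
    have h := ncard_violating_mul_le (o := o) hw hew hwith ih
    rw [hk] at h
    convert h using 2
    rw [← Set.ncard_coe_finset]
    congr 1
    ext l
    simp [B, E]
  have hlevel : ∀ j, ((T (j + 2)).biUnion B).card * 2 ^ (j + 1) ≤ G := by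
    intro j
    have h1 : ((T (j + 2)).biUnion B).card * (2 * A ^ 2) ^ (j + 1) ≤ A ^ (j + 2) * G := by
      calc ((T (j + 2)).biUnion B).card * (2 * A ^ 2) ^ (j + 1)
          ≤ (∑ e ∈ T (j + 2), (B e).card) * (2 * A ^ 2) ^ (j + 1) :=
            Nat.mul_le_mul_right _ Finset.card_biUnion_le
        _ = ∑ e ∈ T (j + 2), (B e).card * (2 * A ^ 2) ^ (j + 1) := Finset.sum_mul _ _ _
        _ ≤ ∑ _e ∈ T (j + 2), G := Finset.sum_le_sum fun e he => hB (j + 2) e he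
        _ = (T (j + 2)).card * G := by rw [Finset.sum_const, smul_eq_mul]
        _ ≤ A ^ (j + 2) * G := Nat.mul_le_mul_right _ (hTcard _)
    have h2 : A ^ (j + 2) ≤ (A ^ 2) ^ (j + 1) := by
      rw [← pow_mul]
      exact Nat.pow_le_pow_right hA (by omega)
    have h3 : 0 < (A ^ 2) ^ (j + 1) := by positivity
    refine Nat.le_of_mul_le_mul_right ?_ h3
    calc ((T (j + 2)).biUnion B).card * 2 ^ (j + 1) * (A ^ 2) ^ (j + 1)
        = ((T (j + 2)).biUnion B).card * (2 * A ^ 2) ^ (j + 1) := by rw [mul_pow, mul_assoc]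
      _ ≤ A ^ (j + 2) * G := h1
      _ ≤ (A ^ 2) ^ (j + 1) * G := Nat.mul_le_mul_right _ h2
      _ = _ := mul_comm _ _
  have hU : U.card ≤ G := by
    have h1 : (U.card : ℝ) ≤ ∑ j ∈ Finset.range (insert w X).card, (1 / 2 : ℝ) ^ j * (G / 2) := by
      have h2 : U.card ≤ ∑ j ∈ Finset.range (insert w X).card, ((T (j + 2)).biUnion B).card :=
        Finset.card_biUnion_le
      refine (Nat.cast_le (α := ℝ).2 h2).trans ?_
      push_cast
      refine Finset.sum_le_sum fun j _ => ?_
      have h3 : (((T (j + 2)).biUnion B).card : ℝ) * 2 ^ (j + 1) ≤ G := by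
        exact_mod_cast hlevel j
      rw [← le_div_iff₀ (by positivity)] at h3
      refine h3.trans (le_of_eq ?_)
      rw [one_div, inv_pow, pow_succ]
      field_simp
    rw [← Finset.sum_mul] at h1
    have h2 := sum_geometric_two_le (insert w X).card
    have h3 : (0 : ℝ) ≤ (G : ℝ) / 2 := by positivity
    have h4 := mul_le_mul_of_nonneg_right h2 h3
    have h5 : (U.card : ℝ) ≤ G := by linarith
    exact_mod_cast h5
  have hsub : E ⊆ (finite_goodOn (P := P) o (insert w X)).toFinset ∪ U := by
    intro l hl
    have hl' : l ∈ P.extensions o X w := by simpa [E] using hl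
    rw [Finset.mem_union, Set.Finite.mem_toFinset]
    by_cases hgood : l ∈ P.goodOn o (insert w X)
    · exact Or.inl hgood
    right
    obtain ⟨e, hwith, hviol⟩ : ∃ e, P.Within e (insert w X) ∧ P.Violates l e := by
      by_contra h
      push Not at h
      exact hgood ⟨hl'.1, h⟩
    have hinv : P.Involves e w := by
      by_contra hno
      have hne : ∀ i ∈ P.idx e, P.left e i ≠ w ∧ P.right e i ≠ w := fun i hi =>
        ⟨fun h => hno ⟨i, hi, Or.inl h⟩, fun h => hno ⟨i, hi, Or.inr h⟩⟩
      refine hl'.2.2 e (fun i hi => ?_) fun i hi => ?_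
      · have h1 := hwith i hi
        rw [Finset.mem_insert, Finset.mem_insert] at h1
        have h2 := hne i hi
        tauto
      · rw [Function.update_of_ne (hne i hi).1, Function.update_of_ne (hne i hi).2]
        exact hviol i hi
    have h2 := P.two_le_card e
    have hle : (P.idx e).card ≤ (insert w X).card :=
      Finset.card_le_card_of_injOn (P.left e) (fun i hi => (hwith i hi).1) (P.left_injOn e)
    refine Finset.mem_biUnion.2 ⟨(P.idx e).card - 2, Finset.mem_range.2 (by omega), ?_⟩
    refine Finset.mem_biUnion.2 ⟨e, (hT _ e).2 ⟨⟨by omega, hinv⟩, hwith⟩, ?_⟩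
    exact Finset.mem_filter.2 ⟨hl, hviol⟩
  have h1 := (Finset.card_le_card hsub).trans (Finset.card_union_le _ _)
  rw [← Set.ncard_eq_toFinset_card _ (finite_extensions o X w),
    ← Set.ncard_eq_toFinset_card _ (finite_goodOn o _), ← hG'] at h1
  have h2 := card_mul_ncard_goodOn_le (P := P) o hw
  rw [← hG] at h2
  have h3 := Nat.mul_le_mul_right G hΩ
  have h4 : G ≤ 2 * A ^ 2 * G := Nat.le_mul_of_pos_left G (by positivity)
  have h5 : 4 * A ^ 2 * G = 2 * A ^ 2 * G + 2 * A ^ 2 * G := by ring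
  omega

theorem goodOn_nonempty [Finite Ω] {A : ℕ} (hA : 1 ≤ A) (hP : P.IsSparse A)
    (hΩ : 4 * A ^ 2 ≤ Nat.card Ω) (o : Ω) (X : Finset V) : (P.goodOn o X).Nonempty := by
  classical
  induction X using Finset.induction_on with
  | empty =>
    refine ⟨fun _ => o, fun _ _ => rfl, fun e he _ => ?_⟩
    obtain ⟨i, hi⟩ : (P.idx e).Nonempty := Finset.card_pos.1 (by have := P.two_le_card e; omega)
    simpa using (he i hi).1
  | insert w X hw ih =>
    have h1 := mul_ncard_goodOn_le_ncard_goodOn_insert hA hP hΩ o X w hw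
    have h2 := (Set.ncard_pos (finite_goodOn o X)).2 ih
    refine (Set.ncard_pos (finite_goodOn o _)).1 (lt_of_lt_of_le ?_ h1)
    positivity

/-- A sparse system of conflicts has a labeling violating none of them: every finite set has good
labelings, so compactness applies. -/
theorem exists_labeling [Finite Ω] {A : ℕ} (hA : 1 ≤ A) (hP : P.IsSparse A)
    (hΩ : 4 * A ^ 2 ≤ Nat.card Ω) : ∃ l : V → Ω, ∀ e, ¬ P.Violates l e := by
  classical
  have hpos : 0 < Nat.card Ω := lt_of_lt_of_le (by positivity) hΩ
  obtain ⟨o⟩ := (Nat.card_pos_iff.1 hpos).1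
  choose g hg using goodOn_nonempty hA hP hΩ o
  obtain ⟨l, hl⟩ := Finset.rado_selection g
  refine ⟨l, fun e he => ?_⟩
  obtain ⟨t, hst, ht⟩ := hl ((P.idx e).image (P.left e) ∪ (P.idx e).image (P.right e))
  have hmem : ∀ i ∈ P.idx e, P.left e i ∈ (P.idx e).image (P.left e) ∪
      (P.idx e).image (P.right e) ∧ P.right e i ∈ (P.idx e).image (P.left e) ∪
      (P.idx e).image (P.right e) := fun i hi =>
    ⟨Finset.mem_union_left _ (Finset.mem_image_of_mem _ hi),
      Finset.mem_union_right _ (Finset.mem_image_of_mem _ hi)⟩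
  refine (hg t).2 e (fun i hi => ⟨hst (hmem i hi).1, hst (hmem i hi).2⟩) fun i hi => ?_
  rw [← ht _ (hmem i hi).1, ← ht _ (hmem i hi).2]
  exact he i hi

end ConflictSystem

end Labelings

/-! ### Comparing the walls of two elements -/

section Conflicts

variable {S Γ : Type*} [Group Γ] {M : CoxeterMatrix S} {cs : CoxeterSystem M Γ} {n : ℕ}

theorem nthWall_inj (hM : IsRightAngled M) {c : S → Fin n} (hc : ∀ s t, M s t = 2 → c s ≠ c t)
    {i j : Fin n} {g : Γ} {k l : ℕ} (hk : k < (colorWalls cs hM c i g).card)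
    (hl : l < (colorWalls cs hM c j g).card)
    (h : nthWall cs hM c i g k = nthWall cs hM c j g l) : i = j ∧ k = l := by
  obtain ⟨h1, h2⟩ := nthWall_spec hM hc hk
  obtain ⟨h3, h4⟩ := nthWall_spec hM hc hl
  have hij : i = j := by
    by_contra hij
    exact Finset.disjoint_left.1 (disjoint_colorWalls hM c hij g g) h1 (h ▸ h3)
  subst hij
  rw [h] at h2
  exact ⟨rfl, by omega⟩

variable (cs) in
open Classical in
/-- The number of walls of colour `i` that separate both `g` and `h` from `1`, enlarged by the
hyperbolicity constant `δ`. Walls of colour `i` are compared from this position on. -/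
noncomputable def startIndex (hM : IsRightAngled M) (c : S → Fin n) (δ : ℕ) (g h : Γ)
    (i : Fin n) : ℕ :=
  (colorWalls cs hM c i g ∩ colorWalls cs hM c i h).card + δ

variable (cs) in
/-- A triple `(g, k, r)` stands for comparing, for every colour `i`, the first `r i` walls of `g`
and of `g * k` from the position `startIndex` on. It is used if these walls exist and make up a
fixed proportion of the walls separating `g` and `g * k`. -/
structure IsComparison (hM : IsRightAngled M) (c : S → Fin n) (δ : ℕ)
    (e : Γ × Γ × (Fin n → ℕ)) : Prop where
  two_le : 2 ≤ ∑ i, e.2.2 i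
  length_le : cs.length e.2.1 ≤ 4 * ∑ i, e.2.2 i
  lt_left : ∀ i, ∀ j < e.2.2 i, startIndex cs hM c δ e.1 (e.1 * e.2.1) i + j <
    (colorWalls cs hM c i e.1).card
  lt_right : ∀ i, ∀ j < e.2.2 i, startIndex cs hM c δ e.1 (e.1 * e.2.1) i + j <
    (colorWalls cs hM c i (e.1 * e.2.1)).card

variable (cs) in
/-- The conflicts that a labeling of the walls has to avoid. -/
noncomputable def wallConflicts (hM : IsRightAngled M) {c : S → Fin n}
    (hc : ∀ s t, M s t = 2 → c s ≠ c t) (δ : ℕ) :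
    ConflictSystem {e // IsComparison cs hM c δ e} (Σ _ : Fin n, ℕ) Γ where
  idx e := Finset.univ.sigma fun i => Finset.range (e.1.2.2 i)
  left e x := nthWall cs hM c x.1 e.1.1
    (startIndex cs hM c δ e.1.1 (e.1.1 * e.1.2.1) x.1 + x.2)
  right e x := nthWall cs hM c x.1 (e.1.1 * e.1.2.1)
    (startIndex cs hM c δ e.1.1 (e.1.1 * e.1.2.1) x.1 + x.2)
  left_injOn := by
    rintro ⟨e, he⟩ ⟨i, j⟩ hij ⟨i', j'⟩ hij' h
    simp only [Finset.coe_sigma, Set.mem_sigma_iff, Finset.coe_range, Set.mem_Iio] at hij hij'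
    obtain ⟨h1, h2⟩ := nthWall_inj hM hc (he.lt_left i j hij.2) (he.lt_left i' j' hij'.2) h
    subst h1
    rw [Nat.add_left_cancel h2]
  right_injOn := by
    rintro ⟨e, he⟩ ⟨i, j⟩ hij ⟨i', j'⟩ hij' h
    simp only [Finset.coe_sigma, Set.mem_sigma_iff, Finset.coe_range, Set.mem_Iio] at hij hij'
    obtain ⟨h1, h2⟩ := nthWall_inj hM hc (he.lt_right i j hij.2) (he.lt_right i' j' hij'.2) h
    subst h1
    rw [Nat.add_left_cancel h2]
  left_ne_right := by
    rintro ⟨e, he⟩ ⟨i, j⟩ hij ⟨i', j'⟩ hij' h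
    rw [Finset.mem_sigma, Finset.mem_range] at hij hij'
    refine nthWall_notMem hM hc (h := e.1 * e.2.1) ?_ (he.lt_left i j hij.2)
      (h ▸ colorWalls_subset_walls hM c i' _ (nthWall_spec hM hc (he.lt_right i' j' hij'.2)).1)
    rw [startIndex]
    omega
  two_le_card := by
    rintro ⟨e, he⟩
    simpa [Finset.card_sigma] using he.two_le

theorem length_inv_mul_le_of_involves (hM : IsRightAngled M) {c : S → Fin n}
    (hc : ∀ s t, M s t = 2 → c s ≠ c t) {δ : ℕ}
    (hδ : IsWallHyperbolic cs hM δ)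
    {e : {e // IsComparison cs hM c δ e}} {w : Γ}
    (hw : (wallConflicts cs hM hc δ).Involves e w) :
    cs.length (w⁻¹ * e.1.1) ≤ 2 * cs.length e.1.2.1 + δ := by
  classical
  obtain ⟨⟨g, k, r⟩, he⟩ := e
  obtain ⟨⟨i, j⟩, hij, hw⟩ := hw
  replace hij : j < r i := by
    have := (Finset.mem_sigma.1 hij).2
    exact Finset.mem_range.1 this
  dsimp only [wallConflicts] at hw ⊢
  have hlen : cs.length (g⁻¹ * (g * k)) = cs.length k := by rw [inv_mul_cancel_left]
  rcases hw with rfl | rfl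
  · have h1 := length_nthWall_inv_mul_le hM hc hδ (h := g * k) (i := i)
      (Nat.le_add_right _ j) (he.lt_left i j hij)
    rw [hlen] at h1
    exact h1.trans (by omega)
  · have h1 := length_nthWall_inv_mul_le hM hc hδ (g := g * k) (h := g) (i := i)
      (k := startIndex cs hM c δ g (g * k) i + j)
      (by rw [startIndex, Finset.inter_comm]; omega) (he.lt_right i j hij)
    rw [← cs.length_inv ((g * k)⁻¹ * g), mul_inv_rev, inv_inv, hlen] at h1
    have h2 := cs.length_mul_le ((nthWall cs hM c i (g * k)
      (startIndex cs hM c δ g (g * k) i + j))⁻¹ * (g * k)) k⁻¹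
    rw [cs.length_inv, mul_assoc, mul_inv_cancel_right] at h2
    omega

/-- The number of comparisons in which a given wall occurs grows at most exponentially with the
number of the compared pairs: by hyperbolicity they all take place near this wall. -/
theorem isSparse_wallConflicts [Finite S] (hM : IsRightAngled M) {c : S → Fin n}
    (hc : ∀ s t, M s t = 2 → c s ≠ c t) {δ : ℕ} (hδ : IsWallHyperbolic cs hM δ) :
    (wallConflicts cs hM hc δ).IsSparse ((Nat.card S + 1) ^ (12 + δ) * 2 ^ n) := by
  classical
  intro w m
  let P := wallConflicts cs hM hc δ
  let f : {e // IsComparison cs hM c δ e} → Γ × Γ × (Fin n → ℕ) :=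
    fun e => (w⁻¹ * e.1.1, e.1.2.1, e.1.2.2)
  have hf : Function.Injective f := by
    rintro ⟨⟨g, k, r⟩, _⟩ ⟨⟨g', k', r'⟩, _⟩ h
    simpa [f] using h
  let R : Finset (Fin n → ℕ) := Fintype.piFinset fun _ => Finset.range (m + 1)
  let X : Set (Γ × Γ × (Fin n → ℕ)) :=
    {g | cs.length g ≤ 8 * m + δ} ×ˢ {g | cs.length g ≤ 4 * m} ×ˢ (R : Set (Fin n → ℕ))
  obtain ⟨hfin1, hcard1⟩ := finite_ncard_length_le cs (8 * m + δ)
  obtain ⟨hfin2, hcard2⟩ := finite_ncard_length_le cs (4 * m)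
  have hXfin : X.Finite := hfin1.prod (hfin2.prod R.finite_toSet)
  have hmaps : ∀ e ∈ {e | (P.idx e).card = m ∧ P.Involves e w}, f e ∈ X := by
    rintro e ⟨hcard, hinv⟩
    have hlen := length_inv_mul_le_of_involves hM hc hδ hinv
    have hsum : ∑ i, e.1.2.2 i = m := by
      simpa [P, wallConflicts, Finset.card_sigma] using hcard
    have hk := e.2.length_le
    rw [hsum] at hk
    refine ⟨?_, hk, ?_⟩
    · change cs.length (w⁻¹ * e.1.1) ≤ 8 * m + δ
      omega
    · rw [Finset.mem_coe, Fintype.mem_piFinset]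
      intro i
      rw [Finset.mem_range, Nat.lt_succ_iff, ← hsum]
      exact Finset.single_le_sum (f := e.1.2.2) (fun _ _ => Nat.zero_le _) (Finset.mem_univ i)
  refine ⟨Set.Finite.of_injOn hmaps hf.injOn hXfin, ?_⟩
  rcases Set.eq_empty_or_nonempty {e | (P.idx e).card = m ∧ P.Involves e w} with h | ⟨e, he, -⟩
  · rw [h]
    simp
  have hm : 2 ≤ m := he ▸ P.two_le_card e
  refine (Set.ncard_le_ncard_of_injOn f hmaps hf.injOn hXfin).trans ?_
  have hR : R.card ≤ (2 ^ m) ^ n := by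
    rw [Fintype.card_piFinset_const, Finset.card_range]
    exact Nat.pow_le_pow_left Nat.lt_two_pow_self n
  rw [Set.ncard_prod, Set.ncard_prod, Set.ncard_coe_finset]
  calc _ ≤ (Nat.card S + 1) ^ (8 * m + δ) * ((Nat.card S + 1) ^ (4 * m) * (2 ^ m) ^ n) :=
        Nat.mul_le_mul hcard1 (Nat.mul_le_mul hcard2 hR)
    _ = (Nat.card S + 1) ^ (12 * m + δ) * 2 ^ (n * m) := by
        rw [← mul_assoc, ← pow_add, ← pow_mul, mul_comm n m]
        congr 2
        ring
    _ ≤ (Nat.card S + 1) ^ ((12 + δ) * m) * 2 ^ (n * m) := by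
        refine Nat.mul_le_mul_right _ (Nat.pow_le_pow_right (Nat.succ_pos _) ?_)
        nlinarith
    _ = _ := by rw [mul_pow, ← pow_mul, ← pow_mul]

end Conflicts

/-! ### The map to a product of trees -/

section Embedding

variable {S Γ : Type*} [Group Γ] {M : CoxeterMatrix S} {cs : CoxeterSystem M Γ} {n : ℕ}

variable (cs) in
/-- The map to a product of trees defined by a labeling `l` of the walls by words of length `m`:
its `i`-th coordinate lists the labels of the walls of colour `i` on the way from `1` to `g`. -/
noncomputable def labelMap {Ω : Type*} (hM : IsRightAngled M) (c : S → Fin n) {m : ℕ} [NeZero m]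
    (l : Γ → Fin m → Ω) (g : Γ) (i : Fin n) : List Ω :=
  concatBlocks m (fun k => l (nthWall cs hM c i g k)) (colorWalls cs hM c i g).card

theorem sum_dist_labelMap_le {Ω : Type*} (hM : IsRightAngled M) {c : S → Fin n}
    (hc : ∀ s t, M s t = 2 → c s ≠ c t) {m : ℕ} [NeZero m] (l : Γ → Fin m → Ω) (g h : Γ) :
    ∑ i, (rootedTree Ω).dist (labelMap cs hM c l g i) (labelMap cs hM c l h i) ≤
      m * cs.length (g⁻¹ * h) := by
  classical
  have key : ∀ i, (rootedTree Ω).dist (labelMap cs hM c l g i) (labelMap cs hM c l h i) +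
      2 * (m * (colorWalls cs hM c i g ∩ colorWalls cs hM c i h).card) ≤
      m * (colorWalls cs hM c i g).card + m * (colorWalls cs hM c i h).card := by
    intro i
    set b := (colorWalls cs hM c i g ∩ colorWalls cs hM c i h).card with hb
    have h1 : concatBlocks m (fun k => l (nthWall cs hM c i g k)) b <+:
        labelMap cs hM c l g i :=
      concatBlocks_prefix (Finset.card_le_card Finset.inter_subset_left)
    have h2 : concatBlocks m (fun k => l (nthWall cs hM c i g k)) b <+:
        labelMap cs hM c l h i := by
      rw [concatBlocks_congr fun k hk => congrArg l (nthWall_eq_of_lt_card_inter hM hc hk)]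
      exact concatBlocks_prefix (Finset.card_le_card Finset.inter_subset_right)
    have h3 := dist_add_two_mul_length_le h1 h2
    simpa only [labelMap, length_concatBlocks] using h3
  have hsum := Finset.sum_le_sum fun i (_ : i ∈ Finset.univ) => key i
  simp only [Finset.sum_add_distrib, ← Finset.mul_sum, sum_card_colorWalls,
    sum_card_colorWalls_inter] at hsum
  have hlen := length_add_two_mul_card_inter_walls (cs := cs) hM g h
  rw [← mul_add, ← hlen] at hsum
  linarith

/-- If the labeling avoids the conflicts between walls, then `labelMap` does not shorten long
distances by more than a factor. -/
theorem mul_length_le_sum_dist_labelMap {Ω : Type*} (hM : IsRightAngled M) {c : S → Fin n}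
    (hc : ∀ s t, M s t = 2 → c s ≠ c t) {δ m : ℕ} [NeZero m] {l : Γ → Fin m → Ω}
    (hl : ∀ e, ¬ (wallConflicts cs hM hc δ).Violates l e) (g h : Γ) :
    m * cs.length (g⁻¹ * h) ≤
      2 * ∑ i, (rootedTree Ω).dist (labelMap cs hM c l g i) (labelMap cs hM c l h i) +
        4 * m * (n * δ + n + 1) := by
  classical
  have hm : 0 < m := Nat.pos_of_neZero m
  choose p hpg hph hp using fun i => exists_prefix_length_add_length_le
    (labelMap cs hM c l g i) (labelMap cs hM c l h i)
  -- the labels of the first `q i` walls of colour `i` of `g` and of `h` agree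
  let q : Fin n → ℕ := fun i => (p i).length / m
  let b : Fin n → ℕ := fun i => (colorWalls cs hM c i g ∩ colorWalls cs hM c i h).card
  let r : Fin n → ℕ := fun i => q i - (b i + δ)
  have hq : ∀ {i k g}, p i <+: labelMap cs hM c l g i → k < q i →
      k < (colorWalls cs hM c i g).card := by
    intro i k g hpre hk
    have h1 := hpre.length_le
    rw [labelMap, length_concatBlocks] at h1
    exact hk.trans_le (Nat.div_le_of_le_mul h1)
  have hrq : ∀ i, ∀ j < r i, b i + δ + j < q i := fun i j hj => by
    have h1 : j < q i - (b i + δ) := hj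
    omega
  have hk : g * (g⁻¹ * h) = h := mul_inv_cancel_left g h
  have hshort : 4 * ∑ i, r i ≤ cs.length (g⁻¹ * h) + 4 := by
    by_contra hlt
    have he : IsComparison cs hM c δ (g, g⁻¹ * h, r) :=
      { two_le := by
          dsimp only
          omega
        length_le := by
          dsimp only
          omega
        lt_left := fun i j hj => by
          dsimp only
          rw [hk]
          exact hq (hpg i) (hrq i j hj)
        lt_right := fun i j hj => by
          dsimp only
          rw [hk]
          exact hq (hph i) (hrq i j hj) }
    refine hl ⟨_, he⟩ fun x hx => ?_
    have hx' : x.2 < r x.1 := Finset.mem_range.1 (Finset.mem_sigma.1 hx).2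
    dsimp only [wallConflicts]
    rw [hk]
    exact eq_of_prefix_concatBlocks (hpg x.1) (hph x.1) (hrq x.1 x.2 hx')
  have key : ∀ i, m * (colorWalls cs hM c i g).card + m * (colorWalls cs hM c i h).card ≤
      (rootedTree Ω).dist (labelMap cs hM c l g i) (labelMap cs hM c l h i) +
        2 * (m * (b i + r i + (δ + 1))) := by
    intro i
    have h1 := hp i
    have h2 : (p i).length ≤ m * (q i + 1) := (Nat.lt_mul_div_succ _ hm).le
    have h3 : m * (q i + 1) ≤ m * (b i + r i + (δ + 1)) := by
      refine Nat.mul_le_mul_left m ?_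
      have h4 : r i = q i - (b i + δ) := rfl
      omega
    rw [labelMap, labelMap, length_concatBlocks, length_concatBlocks] at h1
    rw [labelMap, labelMap]
    omega
  have hsum := Finset.sum_le_sum fun i (_ : i ∈ Finset.univ) => key i
  simp only [Finset.sum_add_distrib, ← Finset.mul_sum, sum_card_colorWalls, b,
    sum_card_colorWalls_inter, Finset.sum_const, Finset.card_univ, Fintype.card_fin,
    smul_eq_mul] at hsum
  have hlen := length_add_two_mul_card_inter_walls (cs := cs) hM g h
  rw [← mul_add, ← hlen] at hsum
  have hmul := Nat.mul_le_mul_left m hshort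
  nlinarith

end Embedding

theorem exists_coloring {S : Type*} {M : CoxeterMatrix S} {n : ℕ}
    (hn : chromaticNumber (nerve M) = (n : ℕ∞)) :
    ∃ c : S → Fin n, ∀ s t, M s t = 2 → c s ≠ c t := by
  classical
  obtain ⟨C⟩ := SimpleGraph.chromaticNumber_le_iff_colorable.1 hn.le
  refine ⟨C, fun s t h => C.valid ⟨ne_of_comm h, {s, t}, ⟨by simp, ?_⟩, by simp⟩⟩
  have h' : M t s = 2 := by rw [M.symmetric]; exact h
  intro x hx y hy hxy
  rw [Finset.mem_insert, Finset.mem_singleton] at hx hy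
  rcases hx with rfl | rfl <;> rcases hy with rfl | rfl <;> first | assumption | contradiction

end RACG

/-- A finitely generated, right-angled, Gromov-hyperbolic Coxeter group whose nerve has chromatic
number `n` admits a quasi-isometric embedding of its Cayley graph into the `n`-fold `l₁`-product
of the binary tree. -/
theorem theorem1 {S Γ : Type*} [Finite S] [Group Γ] (M : CoxeterMatrix S)
    (cs : CoxeterSystem M Γ) (hM : RACG.IsRightAngled M)
    (hyp : RACG.IsGromovHyperbolic (RACG.graphDist (RACG.cayleyGraph cs)))
    (n : ℕ) (hn : RACG.chromaticNumber (RACG.nerve M) = (n : ℕ∞)) :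
    ∃ ψ : Γ → (Fin n → List (Fin 2)),
      RACG.IsQuasiIsometricEmbedding (RACG.graphDist (RACG.cayleyGraph cs))
        (RACG.l1Dist (RACG.graphDist RACG.binaryTree) n) ψ := by
  obtain ⟨c, hc⟩ := RACG.exists_coloring hn
  obtain ⟨δ, hδ⟩ := RACG.exists_isWallHyperbolic hM hyp
  set A := (Nat.card S + 1) ^ (12 + δ) * 2 ^ n with hA
  have hA1 : 1 ≤ A := Nat.succ_le_of_lt (by positivity)
  set m := 4 * A ^ 2 with hm
  have : NeZero m := ⟨by positivity⟩
  have hm1 : (1 : ℝ) ≤ m := by exact_mod_cast Nat.pos_of_neZero m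
  obtain ⟨l, hl⟩ := RACG.ConflictSystem.exists_labeling (Ω := Fin m → Fin 2) hA1
    (RACG.isSparse_wallConflicts hM hc hδ) (by simpa using Nat.lt_two_pow_self.le)
  refine ⟨RACG.labelMap cs hM c l, 2 * m, 2 * m * (n * δ + n + 1), by linarith, by positivity,
    fun g h => ?_⟩
  have hup := RACG.sum_dist_labelMap_le (cs := cs) hM hc l g h
  have hlow := RACG.mul_length_le_sum_dist_labelMap hM hc hl g h
  simp only [RACG.l1Dist, RACG.graphDist, RACG.dist_eq_length, ← Nat.cast_sum]
  set d := cs.length (g⁻¹ * h)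
  set D := ∑ i, RACG.binaryTree.dist (RACG.labelMap cs hM c l g i) (RACG.labelMap cs hM c l h i)
  replace hup : (D : ℝ) ≤ m * d := by exact_mod_cast hup
  replace hlow : (m : ℝ) * d ≤ 2 * D + 4 * m * (n * δ + n + 1) := by exact_mod_cast hlow
  have hd : (0 : ℝ) ≤ d := Nat.cast_nonneg d
  have hC : (0 : ℝ) ≤ 2 * m * (n * δ + n + 1) := by positivity
  have hmd : (d : ℝ) ≤ m * d := le_mul_of_one_le_left hd hm1
  have hinv : (2 * (m : ℝ))⁻¹ * d ≤ d / 2 := by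
    rw [mul_inv, mul_right_comm, ← div_eq_inv_mul, mul_comm]
    exact mul_le_of_le_one_left (by positivity) (inv_le_one_of_one_le₀ hm1)
  constructor
  · linarith
  · linarith
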